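/- Consider the ARX system with output $y_k$ (Participant $0$) and inputs $u_{i,k}$ (Participants $i=1,\dots,m$) $$y_{k+1}=\sum_{j=1}^{p}a_j\,y_{k+1-j}+\sum_{i=1}^{m}\sum_{l=1}^{q_i}b_{i,l}\,u_{i,k+1-l}+\omega_{k+1},\qquad k\ge 0,$$ with $y_k=0$ for $k\le 0$ and $u_{i,k}=0$ for $k<0$. Let $\theta=[a_1,\dots,a_p,b_{1,1},\dots,b_{1,q_1},\dots,b_{m,1},\dots,b_{m,q_m}]^T$ and let $\varphi_k=[y_k,\dots,y_{k+1-p},u_{1,k},\dots,u_{1,k+1-q_1},\dots,u_{m,k},\dots,u_{m,k+1-q_m}]^T$. Let $b_0,b_1,\dots,b_m>0$. The participants send $\bar y_k=y_k+\eta_k$ and $\bar u_{i,k}=u_{i,k}+\xi_{i,k}$, where $\eta_k\sim L(0,b_0)$ ($k\ge1$) and $\xi_{i,k}\sim L(0,b_i)$ ($k\ge0$) are Laplace variables (the density of $L(0,b)$ is $\frac1{2b}e^{-|x|/b}$), and $\eta_k=0$ for $k\le0$, $\xi_{i,k}=0$ for $k<0$. Let $\bar\varphi_k$ be $\varphi_k$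 with $y,u$ replaced by $\bar y,\bar u$. With $\alpha>0$, $\bar P_0=\alpha^{-1}I$ and an arbitrary initial value $\theta_0$, the algorithm is $$\bar a_k=(1+\bar\varphi_k^T\bar P_k\bar\varphi_k)^{-1},\quad \theta_{k+1}=\theta_k+\bar a_k\bar P_k\bar\varphi_k(\bar y_{k+1}-\bar\varphi_k^T\theta_k),\quad \bar P_{k+1}=\bar P_k-\bar a_k\bar P_k\bar\varphi_k\bar\varphi_k^T\bar P_k .$$ Assume: 1. $1-a_1z-\dots-a_pz^p\neq0$ for all complex $|z|\le1$. 2. All the $\eta_k$ ($k\ge1$) and $\xi_{i,k}$ ($k\ge 0$) are mutually independent, and jointly they are independent of the processes $(y,u,\omega)$. 3. $\{\omega_k,\mathscr F_k\}$ is a martingale difference sequence with $\sup_kE(|\omega_{k+1}|^\beta\mid\mathscr F_k)<\infty$ a.s. for some $\beta\ge2$. 4. $\varphi_k$ is $\mathscr F_k$-measurable for every $k\ge0$. 5. Let $A$ be the $p\times p$ companion matrix with ones on the superdiagonal, last row $(a_p,\dots,a_1)$ and zeros elsewhere, and let $c_0>0$, $\lambda\in(0,1)$ be constants with $\|A^k\|\le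 c_0\lambda^k$ for all $k\in\mathbb N$. With $C_1=1+\frac{\sqrt p\,c_0\lambda}{1-\lambda}$ and $C_{i,2}=C_1\sum_{l=1}^{q_i}|b_{i,l}|$, the privacy indices $\varepsilon,\delta>0$ satisfy $$\frac{C_1}{b_0}\delta\le\varepsilon,\qquad\Big(\frac{C_{i,2}}{b_0}+\frac1{b_i}\Big)\delta\le\varepsilon\quad(i=1,\dots,m).$$ 6. With $r_k=e+\sum_{t=0}^k\|\bar\varphi_t\|^2$ and some $\kappa>1$, almost surely as $k\to\infty$, $$\frac{\ln r_{k-1}\,(\ln(e+\ln r_{k-1}))^{\kappa}}{\lambda_{\min}(\bar P_k^{-1})}\to0\ \text{ if }\beta=2,\qquad \frac{\ln r_{k-1}}{\lambda_{\min}(\bar P_k^{-1})}\to0\ \text{ if }\beta>2 .$$ 7. $\sum_{t=1}^k\|\varphi_t\|^2=O(k)$ a.s. 8. There is a constant $\gamma_3>0$ such that $\gamma_3<\liminf_{k\to\infty}\lambda_{\min}(P_k^{-1})/k$ a.s., where $P_k^{-1}=\alpha I+\sum_{t=0}^{k-1}\varphi_t\varphi_t^T$. Then: (i) The algorithm is $\varepsilon$-differentially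 private under $\delta$-adjacency for each participant. That is, for all $T_2\ge T_1\ge1$: let $\mathcal M_1(x)$, $x\in\mathbb R^{T_1}$, be the observation $\bar y_{[1:T_2]}$ when $y_{[1:T_1]}$ is set to $x$ and the later outputs are produced by the system with the same $u$ and $\omega$; and for $i=1,\dots,m$ let $\mathcal M_2^{(i)}(x)$ be the observation $(\bar y_{[1:T_2]},\bar u_{i,[0:T_2-1]})$ when $u_{i,[0:T_1-1]}$ is set to $x$ and the outputs are produced by the system with the same remaining inputs and $\omega$. Then for $\mathcal M=\mathcal M_1$ and for every $\mathcal M=\mathcal M_2^{(i)}$, all $x,x'\in\mathbb R^{T_1}$ with $\|x-x'\|_1\le\delta$ and all Borel sets $D$, $$\mathbb P(\mathcal M(x)\in D)\le e^{\varepsilon}\,\mathbb P(\mathcal M(x')\in D).$$ (ii) For $\tilde\theta_k=\theta-\theta_k$, almost surely $$\limsup_{k\to\infty}\|\tilde\theta_k\|\le2\|\theta\|\sqrt{\frac{p\,b_0^2+\sum_{i=1}^mq_i\,b_i^2}{\gamma_3+2\min_{0\le i\le m}b_i^2}} .$$ -/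

import Mathlib

open MeasureTheory ProbabilityTheory Filter Topology

noncomputable section

/-- `x_{k-j}`, with the convention that a sequence vanishes at negative times. -/
def lag (x : ℕ → ℝ) (k j : ℕ) : ℝ := if j ≤ k then x (k - j) else 0

/-- Orders and coefficients of an ARX system with one output and `m` input participants:
`y_{k+1} = ∑_{j=1}^p a_j y_{k+1-j} + ∑_{i=1}^m ∑_{l=1}^{q_i} b_{i,l} u_{i,k+1-l} + w_{k+1}`.
Coefficients are indexed from `0`: `a j` is the coefficient of `y_{k-j}` and `coefU i l` the
coefficient of `u_{i,k-l}`. -/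
structure ARXModel (m : ℕ) where
  p : ℕ
  q : Fin m → ℕ
  a : Fin p → ℝ
  coefU : (i : Fin m) → Fin (q i) → ℝ

namespace ARXModel

variable {m : ℕ} (S : ARXModel m)

/-- Index set of the coordinates of the parameter vector, of size `p + ∑ i, q i`. -/
abbrev Idx : Type := Fin S.p ⊕ (Σ i : Fin m, Fin (S.q i))

/-- The parameter vector `θ = [a_1, …, a_p, b_{1,1}, …, b_{m,q_m}]`. -/
def theta : EuclideanSpace ℝ S.Idx :=
  WithLp.toLp 2 (Sum.elim S.a fun il => S.coefU il.1 il.2)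

/-- The deterministic part of the right-hand side of the system equation at time `k`. -/
def drift (y : ℕ → ℝ) (u : Fin m → ℕ → ℝ) (k : ℕ) : ℝ :=
  ∑ j : Fin S.p, S.a j * lag y k j + ∑ i : Fin m, ∑ l : Fin (S.q i), S.coefU i l * lag (u i) k l

/-- `y` is the output of the system with inputs `u` and system noise `w` (`y` is zero up to
time `0`). -/
def IsOutput (y : ℕ → ℝ) (u : Fin m → ℕ → ℝ) (w : ℕ → ℝ) : Prop :=
  y 0 = 0 ∧ ∀ k, y (k + 1) = S.drift y u k + w (k + 1)

/-- The output sequence when `y_1, …, y_T` are prescribed to be `x 0, …, x (T-1)` and the later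
values are produced by the system with inputs `u` and system noise `w`. -/
def output (T : ℕ) (x : Fin T → ℝ) (u : Fin m → ℕ → ℝ) (w : ℕ → ℝ) : ℕ → ℝ
  | 0 => 0
  | k + 1 =>
    if h : k < T then x ⟨k, h⟩
    else S.drift (fun n => if _h : n ≤ k then output T x u w n else 0) u k + w (k + 1)
  termination_by n => n

/-- The regression vector
`[y_k, …, y_{k+1-p}, u_{1,k}, …, u_{1,k+1-q_1}, …, u_{m,k}, …, u_{m,k+1-q_m}]` of random
sequences `y`, `u`. -/
def regressor {Ω : Type*} (y : ℕ → Ω → ℝ) (u : Fin m → ℕ → Ω → ℝ) (k : ℕ) (ω : Ω) :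
    EuclideanSpace ℝ S.Idx :=
  WithLp.toLp 2 (Sum.elim (fun j => lag (fun n => y n ω) k j)
    fun il => lag (fun n => u il.1 n ω) k il.2)

/-- Asymptotic stability: `1 - a_1 z - ⋯ - a_p z^p ≠ 0` for all complex `z` with `|z| ≤ 1`. -/
def IsStable : Prop :=
  ∀ z : ℂ, ‖z‖ ≤ 1 → 1 - ∑ j : Fin S.p, (S.a j : ℂ) * z ^ ((j : ℕ) + 1) ≠ 0

/-- The companion matrix: ones on the superdiagonal, last row `a_p, a_{p-1}, …, a_1`. -/
def companion : Matrix (Fin S.p) (Fin S.p) ℝ := fun i j =>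
  if (i : ℕ) + 1 = S.p then S.a j.rev else if (j : ℕ) = i + 1 then 1 else 0

/-- `‖A^k‖ ≤ c₀ lam^k` for all `k`, with the operator norm induced by the Euclidean norm. -/
def CompanionBound (c₀ lam : ℝ) : Prop :=
  ∀ k : ℕ, ‖Matrix.toEuclideanCLM (𝕜 := ℝ) (S.companion ^ k)‖ ≤ c₀ * lam ^ k

/-- `C_1 = 1 + √p c₀ lam / (1 - lam)`. -/
def privacyConstOutput (c₀ lam : ℝ) : ℝ := 1 + √(S.p : ℝ) * c₀ * lam / (1 - lam)

/-- `C_{i,2} = (1 + √p c₀ lam / (1 - lam)) ∑_l |b_{i,l}|`. -/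
def privacyConstInput (c₀ lam : ℝ) (i : Fin m) : ℝ :=
  (1 + √(S.p : ℝ) * c₀ * lam / (1 - lam)) * ∑ l, |S.coefU i l|

/-- What an attacker observes, as a function of the sensitive outputs `x = y_{[1:T₁]}`: the noisy
outputs `(y_1 + η_1, …, y_{T₂} + η_{T₂})`. The inputs `u` and the system noise `w` are kept. -/
def outputMechanism {Ω : Type*} (u : Fin m → ℕ → Ω → ℝ) (w : ℕ → Ω → ℝ) (η : ℕ → Ω → ℝ)
    (T₁ T₂ : ℕ) (x : Fin T₁ → ℝ) (ω : Ω) : Fin T₂ → ℝ := fun k =>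
  S.output T₁ x (fun i n => u i n ω) (fun n => w n ω) (k + 1) + η (k + 1) ω

/-- The inputs `u` in which `u_{i,0}, …, u_{i,T-1}` are replaced by `x`. -/
def replaceInput (i : Fin m) (T : ℕ) (x : Fin T → ℝ) (u : Fin m → ℕ → ℝ) : Fin m → ℕ → ℝ :=
  Function.update u i fun k => if h : k < T then x ⟨k, h⟩ else u i k

/-- What an attacker observes, as a function of the sensitive inputs `x = u_{i,[0:T₁-1]}`: the
noisy outputs `(y_k + η_k)_{1 ≤ k ≤ T₂}` and the noisy inputs `(u_{i,k} + ξ_{i,k})_{0 ≤ k < T₂}`.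
All other inputs and the system noise are kept. -/
def inputMechanism {Ω : Type*} (u : Fin m → ℕ → Ω → ℝ) (w : ℕ → Ω → ℝ) (η : ℕ → Ω → ℝ)
    (ξ : Fin m → ℕ → Ω → ℝ) (i : Fin m) (T₁ T₂ : ℕ) (x : Fin T₁ → ℝ) (ω : Ω) :
    (Fin T₂ → ℝ) × (Fin T₂ → ℝ) :=
  let u' := replaceInput i T₁ x fun j n => u j n ω
  (fun k => S.output 0 Fin.elim0 u' (fun n => w n ω) (k + 1) + η (k + 1) ω,
    fun k => u' i k + ξ i k ω)

end ARXModel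

/-- `ε`-differential privacy of a random mechanism `M` under `δ`-adjacency for the distance `d`. -/
def IsDifferentiallyPrivate {Ω X Y : Type*} [MeasurableSpace Ω] [MeasurableSpace Y]
    (P : Measure Ω) (d : X → X → ℝ) (M : X → Ω → Y) (ε δ : ℝ) : Prop :=
  ∀ x x' : X, d x x' ≤ δ → ∀ D : Set Y, MeasurableSet D →
    P {ω | M x ω ∈ D} ≤ ENNReal.ofReal (Real.exp ε) * P {ω | M x' ω ∈ D}

/-- The distance `‖x - x'‖₁ = ∑ |x_i - x'_i|`. -/
def l1Dist {n : ℕ} (x x' : Fin n → ℝ) : ℝ := ∑ i, |x i - x' i|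

/-- The Laplace distribution `L(0, b)`, with density `(1 / (2b)) exp(-|x| / b)`. -/
def laplaceMeasure (b : ℝ) : Measure ℝ :=
  volume.withDensity fun x => ENNReal.ofReal (1 / (2 * b) * Real.exp (-|x| / b))

/-- Assumptions on the privacy noises: `η_k ∼ L(0, b_0)` for `k ≥ 1` (and `η_0 = 0`),
`ξ_{i,k} ∼ L(0, b_i)` for `k ≥ 0`, all of these variables are independent, and together they are
independent of the processes `y`, `u`, `w`. -/
structure PrivacyNoise {Ω : Type*} [MeasurableSpace Ω] (P : Measure Ω) {m : ℕ}
    (b : Fin (m + 1) → ℝ) (η : ℕ → Ω → ℝ) (ξ : Fin m → ℕ → Ω → ℝ)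
    (y : ℕ → Ω → ℝ) (u : Fin m → ℕ → Ω → ℝ) (w : ℕ → Ω → ℝ) : Prop where
  measurable_eta : ∀ k, Measurable (η k)
  measurable_xi : ∀ i k, Measurable (ξ i k)
  eta_zero : ∀ ω, η 0 ω = 0
  law_eta : ∀ k, P.map (η (k + 1)) = laplaceMeasure (b 0)
  law_xi : ∀ i k, P.map (ξ i k) = laplaceMeasure (b i.succ)
  iIndep : iIndepFun
    (Sum.elim (fun k => η (k + 1)) (fun ik => ξ ik.1 ik.2) : ℕ ⊕ (Fin m × ℕ) → Ω → ℝ) P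
  indep : IndepFun
    (fun ω => ((fun k => η (k + 1) ω, fun i k => ξ i k ω) : (ℕ → ℝ) × (Fin m → ℕ → ℝ)))
    (fun ω => ((fun k => y k ω, fun i k => u i k ω, fun k => w (k + 1) ω) :
      (ℕ → ℝ) × (Fin m → ℕ → ℝ) × (ℕ → ℝ))) P

/-- `(w_k, ℱ_k)` is a martingale difference sequence and
`sup_k E(|w_{k+1}|^β | ℱ_k) < ∞` almost surely (conditional expectation of a nonnegative,
not necessarily integrable, variable). -/
structure SystemNoise {Ω : Type*} [mΩ : MeasurableSpace Ω] (P : Measure Ω)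
    (ℱ : Filtration ℕ mΩ) (β : ℝ) (w : ℕ → Ω → ℝ) : Prop where
  adapted : ∀ k, Measurable[ℱ (k + 1)] (w (k + 1))
  integrable : ∀ k, Integrable (w (k + 1)) P
  condExp_eq_zero : ∀ k, P[w (k + 1)|ℱ k] =ᵐ[P] 0
  moment : ∀ᵐ ω ∂P,
    ⨆ k : ℕ, condLExp (ℱ k) P (fun ω' => ENNReal.ofReal (|w (k + 1) ω'| ^ β)) ω < ⊤

/-- The smallest (real) eigenvalue of a square matrix. -/
def lamMin {ι : Type*} [Fintype ι] [DecidableEq ι] (M : Matrix ι ι ℝ) : ℝ :=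
  sInf {μ : ℝ | Module.End.HasEigenvalue (Matrix.toLin' M) μ}

section LeastSquares

variable {ι : Type*} [Fintype ι] [DecidableEq ι]

/-- The information matrix `α I + ∑_{t<k} φ_t φ_tᵀ`. -/
def infoMatrix (α : ℝ) (φ : ℕ → EuclideanSpace ℝ ι) (k : ℕ) : Matrix ι ι ℝ :=
  α • (1 : Matrix ι ι ℝ) +
    ∑ t ∈ Finset.range k, Matrix.vecMulVec (φ t).ofLp (φ t).ofLp

/-- `P_k`, given by `P_0 = α⁻¹ I`, `P_{k+1} = P_k - a_k P_k φ_k φ_kᵀ P_k` with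
`a_k = (1 + φ_kᵀ P_k φ_k)⁻¹`. -/
def rlsCov (α : ℝ) (φ : ℕ → EuclideanSpace ℝ ι) : ℕ → Matrix ι ι ℝ
  | 0 => α⁻¹ • (1 : Matrix ι ι ℝ)
  | k + 1 =>
    let Pk := rlsCov α φ k
    let v := (φ k).ofLp
    Pk - (1 + dotProduct v (Pk.mulVec v))⁻¹ • (Pk * Matrix.vecMulVec v v * Pk)

/-- The recursive least-squares estimate `θ_k` computed from regression vectors `φ` and
observations `y`: `θ_{k+1} = θ_k + a_k P_k φ_k (y_{k+1} - φ_kᵀ θ_k)`. -/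
def rlsEstimate (α : ℝ) (θ₀ : EuclideanSpace ℝ ι) (φ : ℕ → EuclideanSpace ℝ ι) (y : ℕ → ℝ) :
    ℕ → EuclideanSpace ℝ ι
  | 0 => θ₀
  | k + 1 =>
    let θk := rlsEstimate α θ₀ φ y k
    let Pk := rlsCov α φ k
    let v := (φ k).ofLp
    θk + ((1 + dotProduct v (Pk.mulVec v))⁻¹ * (y (k + 1) - dotProduct v θk.ofLp)) •
      WithLp.toLp 2 (Pk.mulVec v)

end LeastSquares

/-- `r_k = e + ∑_{t=0}^k ‖φ_t‖²`. -/
def regressorEnergy {ι : Type*} [Fintype ι] (φ : ℕ → EuclideanSpace ℝ ι) (k : ℕ) : ℝ :=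
  Real.exp 1 + ∑ t ∈ Finset.range (k + 1), ‖φ t‖ ^ 2

/-- `ln r (ln (e + ln r))^κ` when `β = 2`, and `ln r` when `β > 2`. -/
def excitationGauge (β κ r : ℝ) : ℝ :=
  if β = 2 then Real.log r * Real.log (Real.exp 1 + Real.log r) ^ κ else Real.log r

end

noncomputable section

/-! ### Convergence of martingale transforms -/

/-- The hypothesis compares the measures with densities `X` and `C` on the smaller σ-algebra, and an
`m`-measurable `f` only sees these trimmed measures. This is monotonicity of conditional expectation
without any integrability. -/
theorem lintegral_mul_le_of_setLIntegral_le {Ω : Type*} {m mΩ : MeasurableSpace Ω}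
    {P : Measure Ω} (hm : m ≤ mΩ) {X C f : Ω → ENNReal}
    (hX : Measurable X) (hC : Measurable C) (hf : Measurable[m] f)
    (h : ∀ s, MeasurableSet[m] s → ∫⁻ ω in s, X ω ∂P ≤ ∫⁻ ω in s, C ω ∂P) :
    ∫⁻ ω, f ω * X ω ∂P ≤ ∫⁻ ω, f ω * C ω ∂P := by
  have hf' : Measurable f := hf.mono hm le_rfl
  have key : (P.withDensity X).trim hm ≤ (P.withDensity C).trim hm := by
    refine Measure.le_iff.2 fun s hs => ?_
    rw [trim_measurableSet_eq hm hs, trim_measurableSet_eq hm hs, withDensity_apply _ (hm s hs),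
      withDensity_apply _ (hm s hs)]
    exact h s hs
  calc ∫⁻ ω, f ω * X ω ∂P = ∫⁻ ω, f ω ∂(P.withDensity X) := by
        rw [lintegral_withDensity_eq_lintegral_mul _ hX hf']
        simp [mul_comm]
    _ = ∫⁻ ω, f ω ∂((P.withDensity X).trim hm) := (lintegral_trim hm hf).symm
    _ ≤ ∫⁻ ω, f ω ∂((P.withDensity C).trim hm) := lintegral_mono' key le_rfl
    _ = ∫⁻ ω, f ω ∂(P.withDensity C) := lintegral_trim hm hf
    _ = ∫⁻ ω, f ω * C ω ∂P := by
        rw [lintegral_withDensity_eq_lintegral_mul _ hC hf']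
        simp [mul_comm]

/-- A square-summable series of martingale differences converges almost surely. -/
theorem ae_tendsto_sum_of_martingaleDiff {Ω : Type*} [mΩ : MeasurableSpace Ω] {P : Measure Ω}
    [IsProbabilityMeasure P] (G : Filtration ℕ mΩ) (D : ℕ → Ω → ℝ)
    (hmeas : ∀ k, Measurable[G (k + 1)] (D k)) (hL2 : ∀ k, MemLp (D k) 2 P)
    (hcond : ∀ k, P[D k|G k] =ᵐ[P] 0) (R : ℝ)
    (hsum : ∀ n, ∑ k ∈ Finset.range n, ∫ ω, D k ω ^ 2 ∂P ≤ R) :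
    ∀ᵐ ω ∂P, ∃ c, Tendsto (fun n => ∑ k ∈ Finset.range n, D k ω) atTop (𝓝 c) := by
  set M : ℕ → Ω → ℝ := fun n => ∑ k ∈ Finset.range n, D k with hM
  have hMmeas : ∀ n, StronglyMeasurable[G n] (M n) := fun n =>
    Finset.stronglyMeasurable_sum _ fun k hk =>
      ((hmeas k).mono (G.mono (Finset.mem_range.1 hk)) le_rfl).stronglyMeasurable
  have hML2 : ∀ n, MemLp (M n) 2 P := fun n => memLp_finsetSum' _ fun k _ => hL2 k
  have hMint : ∀ n, Integrable (M n) P := fun n => (hML2 n).integrable (by norm_num)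
  have hsucc : ∀ n, M (n + 1) - M n = D n := fun n => by
    simp [hM, Finset.sum_range_succ]
  have hsub : Submartingale M G P := by
    refine submartingale_of_condExp_sub_nonneg_nat hMmeas hMint fun n => ?_
    rw [hsucc]
    exact (hcond n).symm.le
  -- Martingale increments are orthogonal: the cross term has conditional expectation zero given `G
  -- n`.
  have hsq : ∀ n, ∫ ω, M n ω ^ 2 ∂P = ∑ k ∈ Finset.range n, ∫ ω, D k ω ^ 2 ∂P := by
    intro n
    induction n with
    | zero => simp [hM]
    | succ n ih =>
      rw [Finset.sum_range_succ, ← ih]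
      have hMD : Integrable (M n * D n) P := (hML2 n).integrable_mul (hL2 n)
      have hcross : ∫ ω, (M n * D n) ω ∂P = 0 := by
        rw [← integral_condExp (G.le n)]
        have h1 := condExp_mul_of_stronglyMeasurable_left (hMmeas n) hMD
          ((hL2 n).integrable (by norm_num))
        have h2 : P[M n * D n|G n] =ᵐ[P] 0 := by
          filter_upwards [h1, hcond n] with ω e1 e2
          rw [e1]; simp [e2]
        rw [integral_congr_ae h2]; simp
      have hexp : ∀ ω, M (n + 1) ω ^ 2 = M n ω ^ 2 + 2 * (M n * D n) ω + D n ω ^ 2 := by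
        intro ω
        have : M (n + 1) ω = M n ω + D n ω := by simp [hM, Finset.sum_range_succ]
        rw [this, Pi.mul_apply]; ring
      simp_rw [hexp]
      have hi1 : Integrable (fun ω => M n ω ^ 2) P := (hML2 n).integrable_sq
      have hi2 : Integrable (fun ω => 2 * (M n * D n) ω) P := hMD.const_mul 2
      have hi3 : Integrable (fun ω => M n ω ^ 2 + 2 * (M n * D n) ω) P := hi1.add hi2
      rw [integral_add hi3 (hL2 n).integrable_sq, integral_add hi1 hi2, integral_const_mul, hcross]
      ring
  have hR : 0 ≤ R := by simpa using hsum 0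
  -- On a probability space the L¹ norm is at most the L² norm, hence at most `√R`; this is the
  -- input of the submartingale convergence theorem.
  have hbdd : ∀ n, eLpNorm (M n) 1 P ≤ (Real.sqrt R).toNNReal := by
    intro n
    refine (eLpNorm_le_eLpNorm_of_exponent_le (p := 1) (q := 2) (by norm_num)
      (hML2 n).aestronglyMeasurable).trans ?_
    rw [(hML2 n).eLpNorm_eq_integral_rpow_norm (by norm_num) (by norm_num)]
    change ENNReal.ofReal _ ≤ ENNReal.ofReal _
    refine ENNReal.ofReal_le_ofReal ?_
    rw [Real.sqrt_eq_rpow]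
    have : ∫ ω, ‖M n ω‖ ^ (2 : ENNReal).toReal ∂P = ∫ ω, M n ω ^ 2 ∂P := by
      simp
    rw [this, hsq]
    norm_num
    refine Real.rpow_le_rpow ?_ (hsum n) (by norm_num)
    exact Finset.sum_nonneg fun k _ => integral_nonneg fun ω => sq_nonneg _
  have := hsub.exists_ae_tendsto_of_bdd hbdd
  filter_upwards [this] with ω hω
  simpa [hM] using hω

/-- Localization: nonnegative terms dominated, on predictable sets, by predictable terms with an
almost surely finite sum. -/
theorem exists_predictable_localization {Ω : Type*} [mΩ : MeasurableSpace Ω] {P : Measure Ω}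
    [IsProbabilityMeasure P] (G : Filtration ℕ mΩ) (X C : ℕ → Ω → ENNReal)
    (hC : ∀ k, Measurable[G k] (C k))
    (h : ∀ k s, MeasurableSet[G k] s → ∫⁻ ω in s, X k ω ∂P ≤ ∫⁻ ω in s, C k ω ∂P)
    (K : ℕ) :
    ∃ A : ℕ → Set Ω, (∀ k, MeasurableSet[G k] (A k)) ∧
      ∑' k, ∫⁻ ω in A k, X k ω ∂P ≤ K ∧
      ∀ ω, ∑' k, C k ω ≤ K → ∀ k, ω ∈ A k := by
  have hCm : ∀ k, Measurable (C k) := fun k => (hC k).mono (G.le k) le_rfl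
  -- The partial sum includes the term `C k` itself; the set is still `G k`-measurable because `C`
  -- is predictable.
  refine ⟨fun k => {ω | ∑ j ∈ Finset.range (k + 1), C j ω ≤ K}, fun k => ?_, ?_, ?_⟩
  · refine measurableSet_le (Finset.measurable_sum _ fun j hj => ?_) measurable_const
    exact (hC j).mono (G.mono (by simpa [Nat.lt_succ_iff] using hj)) le_rfl
  · have hA : ∀ k, MeasurableSet[G k] {ω | ∑ j ∈ Finset.range (k + 1), C j ω ≤ K} := fun k =>
      measurableSet_le (Finset.measurable_sum _ fun j hj =>
        (hC j).mono (G.mono (by simpa [Nat.lt_succ_iff] using hj)) le_rfl) measurable_const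
    calc ∑' k, ∫⁻ ω in {ω | ∑ j ∈ Finset.range (k + 1), C j ω ≤ K}, X k ω ∂P
        ≤ ∑' k, ∫⁻ ω in {ω | ∑ j ∈ Finset.range (k + 1), C j ω ≤ K}, C k ω ∂P :=
          ENNReal.tsum_le_tsum fun k => h k _ (hA k)
      _ = ∑' k, ∫⁻ ω, Set.indicator {ω | ∑ j ∈ Finset.range (k + 1), C j ω ≤ K} (C k) ω ∂P := by
          congr 1; ext k; rw [lintegral_indicator (G.le k _ (hA k))]
      _ = ∫⁻ ω, ∑' k, Set.indicator {ω | ∑ j ∈ Finset.range (k + 1), C j ω ≤ K} (C k) ω ∂P :=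
          (lintegral_tsum fun k => ((hCm k).indicator (G.le k _ (hA k))).aemeasurable).symm
      _ ≤ ∫⁻ _, (K : ENNReal) ∂P := by
          refine lintegral_mono fun ω => ?_
          rw [ENNReal.tsum_eq_iSup_nat]
          refine iSup_le fun n => ?_
          -- Up to the last index where the partial sum of `C` is at most `K` the bound is
          -- immediate; every later truncated term is zero.
          induction n with
          | zero => simp
          | succ n ih =>
            by_cases hn : ∑ j ∈ Finset.range (n + 1), C j ω ≤ K
            · refine le_trans (Finset.sum_le_sum fun k _ => ?_) hn
              exact Set.indicator_le_self _ _ _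
            · rw [Finset.sum_range_succ, Set.indicator_of_notMem (by simpa using hn), add_zero]
              exact ih
      _ = K := by simp
  · intro ω hω k
    exact (ENNReal.sum_le_tsum _).trans hω

/-- Removes the localization level: the events `S ≤ K` exhaust the event that `S` is finite. -/
theorem ae_forall_of_nat_le {Ω : Type*} [MeasurableSpace Ω] {P : Measure Ω} {S : Ω → ENNReal}
    {p : Ω → Prop} (hS : ∀ᵐ ω ∂P, S ω < ⊤) (h : ∀ K : ℕ, ∀ᵐ ω ∂P, S ω ≤ K → p ω) :
    ∀ᵐ ω ∂P, p ω := by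
  filter_upwards [hS, ae_all_iff.2 h] with ω h1 h2
  obtain ⟨K, hK⟩ := ENNReal.exists_nat_gt h1.ne
  exact h2 K hK.le

/-- Nonnegative adapted terms are summable where their predictable bounds are. -/
theorem ae_tsum_lt_top_of_predictable {Ω : Type*} [mΩ : MeasurableSpace Ω] {P : Measure Ω}
    [IsProbabilityMeasure P] (G : Filtration ℕ mΩ) (X C : ℕ → Ω → ENNReal)
    (hX : ∀ k, Measurable (X k)) (hC : ∀ k, Measurable[G k] (C k))
    (h : ∀ k s, MeasurableSet[G k] s → ∫⁻ ω in s, X k ω ∂P ≤ ∫⁻ ω in s, C k ω ∂P)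
    (hfin : ∀ᵐ ω ∂P, ∑' k, C k ω < ⊤) :
    ∀ᵐ ω ∂P, ∑' k, X k ω < ⊤ := by
  refine ae_forall_of_nat_le hfin fun K => ?_
  obtain ⟨A, hA, hAK, hAmem⟩ := exists_predictable_localization G X C hC h K
  -- The truncated series has expectation at most `K`, and on the event that the bounds sum to at
  -- most `K` the truncation changes nothing.
  have hlt : ∫⁻ ω, ∑' k, (A k).indicator (X k) ω ∂P ≠ ⊤ := by
    rw [lintegral_tsum fun k => ((hX k).indicator (G.le k _ (hA k))).aemeasurable]
    refine ne_top_of_le_ne_top (ENNReal.natCast_ne_top K) (le_trans (le_of_eq ?_) hAK)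
    congr 1; ext k; rw [lintegral_indicator (G.le k _ (hA k))]
  filter_upwards [ae_lt_top (Measurable.tsum fun k =>
    (hX k).indicator (G.le k _ (hA k))) hlt] with ω hω hK
  convert hω using 3 with k
  rw [Set.indicator_of_mem (hAmem ω hK k)]

/-- Local convergence theorem for martingale transforms. -/
theorem ae_tendsto_sum_martingale_transform {Ω : Type*} [mΩ : MeasurableSpace Ω] {P : Measure Ω}
    [IsProbabilityMeasure P] (G : Filtration ℕ mΩ) (V X : ℕ → Ω → ℝ) (C : ℕ → Ω → ENNReal)
    (hV : ∀ k, Measurable[G k] (V k)) (hX : ∀ k, Measurable[G (k + 1)] (X k))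
    (hXint : ∀ k, Integrable (X k) P) (hcond : ∀ k, P[X k|G k] =ᵐ[P] 0)
    (hC : ∀ k, Measurable[G k] (C k))
    (h : ∀ k s, MeasurableSet[G k] s →
      ∫⁻ ω in s, ENNReal.ofReal (X k ω ^ 2) ∂P ≤ ∫⁻ ω in s, C k ω ∂P)
    (hfin : ∀ᵐ ω ∂P, ∑' k, ENNReal.ofReal (V k ω ^ 2) * C k ω < ⊤) :
    ∀ᵐ ω ∂P, ∃ c, Tendsto (fun n => ∑ k ∈ Finset.range n, V k ω * X k ω) atTop (𝓝 c) := by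
  have hXm : ∀ k, Measurable (X k) := fun k => (hX k).mono (G.le _) le_rfl
  have hVm : ∀ k, Measurable (V k) := fun k => (hV k).mono (G.le _) le_rfl
  have hV2 : ∀ k, Measurable[G k] fun ω => ENNReal.ofReal (V k ω ^ 2) := fun k =>
    ENNReal.measurable_ofReal.comp ((hV k).pow_const 2)
  refine ae_forall_of_nat_le hfin fun K => ?_
  have hdom : ∀ k s, MeasurableSet[G k] s →
      ∫⁻ ω in s, ENNReal.ofReal ((V k ω * X k ω) ^ 2) ∂P ≤
        ∫⁻ ω in s, ENNReal.ofReal (V k ω ^ 2) * C k ω ∂P := by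
    intro k s hs
    have := lintegral_mul_le_of_setLIntegral_le (P := P.restrict s) (G.le k)
      (X := fun ω => ENNReal.ofReal (X k ω ^ 2)) (C := C k)
      (f := fun ω => ENNReal.ofReal (V k ω ^ 2))
      (ENNReal.measurable_ofReal.comp ((hXm k).pow_const 2)) ((hC k).mono (G.le k) le_rfl)
      (hV2 k) (fun t ht => by
        rw [Measure.restrict_restrict (G.le k t ht)]
        exact h k _ (ht.inter hs))
    refine le_trans (le_of_eq ?_) this
    congr 1; ext ω
    rw [mul_pow, ENNReal.ofReal_mul (sq_nonneg _)]
  obtain ⟨A, hA, hAK, hAmem⟩ := exists_predictable_localization G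
    (fun k ω => ENNReal.ofReal ((V k ω * X k ω) ^ 2))
    (fun k ω => ENNReal.ofReal (V k ω ^ 2) * C k ω)
    (fun k => (hV2 k).mul (hC k)) hdom K
  -- Truncating the weights keeps them predictable, so the products remain martingale differences.
  -- They are now square integrable with total second moment at most `K`, although `V k * X k` need
  -- not be integrable.
  set W : ℕ → Ω → ℝ := fun k => (A k).indicator (V k) with hW
  have hWm : ∀ k, Measurable[G k] (W k) := fun k => (hV k).indicator (hA k)
  have hDm : ∀ k, Measurable[G (k + 1)] (W k * X k) := fun k =>
    ((hWm k).mono (G.mono k.le_succ) le_rfl).mul (hX k)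
  have hlint : ∀ k, ∫⁻ ω, ENNReal.ofReal ((W k * X k) ω ^ 2) ∂P =
      ∫⁻ ω in A k, ENNReal.ofReal ((V k ω * X k ω) ^ 2) ∂P := by
    intro k
    rw [← lintegral_indicator (G.le k _ (hA k))]
    congr 1; ext ω
    by_cases hω : ω ∈ A k <;> simp [hW, hω]
  have hle : ∀ k, ∫⁻ ω, ENNReal.ofReal ((W k * X k) ω ^ 2) ∂P ≤ K := fun k =>
    (hlint k).le.trans ((ENNReal.le_tsum k).trans hAK)
  have hL2 : ∀ k, MemLp (W k * X k) 2 P := by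
    intro k
    have hm := ((hDm k).mono (G.le _) le_rfl)
    rw [memLp_two_iff_integrable_sq hm.aestronglyMeasurable]
    refine ⟨(hm.pow_const 2).aestronglyMeasurable, ?_⟩
    rw [hasFiniteIntegral_iff_ofReal (ae_of_all _ fun ω => sq_nonneg _)]
    exact (hle k).trans_lt (ENNReal.natCast_lt_top K)
  have hmain := ae_tendsto_sum_of_martingaleDiff G (fun k => W k * X k) hDm hL2 (fun k => by
      have h1 := condExp_mul_of_stronglyMeasurable_left (hWm k).stronglyMeasurable
        ((hL2 k).integrable (by norm_num)) (hXint k)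
      filter_upwards [h1, hcond k] with ω e1 e2
      rw [e1]; simp [e2]) K (fun n => by
      have : ∀ k, ∫ ω, (W k * X k) ω ^ 2 ∂P =
          (∫⁻ ω, ENNReal.ofReal ((W k * X k) ω ^ 2) ∂P).toReal := fun k =>
        integral_eq_lintegral_of_nonneg_ae (ae_of_all _ fun ω => sq_nonneg _)
          (hL2 k).integrable_sq.aestronglyMeasurable
      simp_rw [this]
      rw [← ENNReal.toReal_sum fun k _ => ((hle k).trans_lt (ENNReal.natCast_lt_top K)).ne]
      refine ENNReal.toReal_le_of_le_ofReal (by positivity) ?_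
      rw [ENNReal.ofReal_natCast]
      refine le_trans (ENNReal.sum_le_tsum _) ?_
      simp_rw [hlint]
      exact hAK)
  filter_upwards [hmain] with ω ⟨c, hc⟩ hK
  refine ⟨c, ?_⟩
  convert hc using 3 with n k
  simp [hW, hAmem ω hK]

/-! ### Kronecker's lemma and weights of linear growth -/

/-- **Kronecker's lemma** for the weights `1 / (k + 1)`. -/
theorem tendsto_average_of_tendsto_sum_div {x : ℕ → ℝ} {c : ℝ}
    (h : Tendsto (fun n => ∑ k ∈ Finset.range n, x k / ((k : ℝ) + 1)) atTop (𝓝 c)) :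
    Tendsto (fun n : ℕ => (n : ℝ)⁻¹ * ∑ k ∈ Finset.range n, x k) atTop (𝓝 0) := by
  set s : ℕ → ℝ := fun n => ∑ k ∈ Finset.range n, x k / ((k : ℝ) + 1) with hs
  -- Summation by parts with `x k = (k + 1) (s (k + 1) - s k)`: the average of `x` is `s n` minus
  -- its Cesàro mean, and both have the limit `c`.
  have habel : ∀ n : ℕ, ∑ k ∈ Finset.range n, x k = n * s n - ∑ k ∈ Finset.range n, s k := by
    intro n
    induction n with
    | zero => simp
    | succ n ih =>
      have h1 : s (n + 1) = s n + x n / ((n : ℝ) + 1) := Finset.sum_range_succ _ _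
      rw [Finset.sum_range_succ, Finset.sum_range_succ, ih, h1]
      have : ((n : ℝ) + 1) ≠ 0 := by positivity
      push_cast
      field_simp
      ring
  have h2 := h.sub h.cesaro
  rw [sub_self] at h2
  refine h2.congr' ?_
  filter_upwards [eventually_gt_atTop 0] with n hn
  have : (n : ℝ) ≠ 0 := by positivity
  rw [habel]
  field_simp

/-- Squares with partial sums `O(n)` are summable against `1 / (k + 1) ^ 2`. -/
theorem summable_sq_div_of_sum_le {v : ℕ → ℝ} {B : ℝ}
    (h : ∀ n : ℕ, ∑ k ∈ Finset.range n, v k ^ 2 ≤ B * n) :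
    Summable fun k : ℕ => (v k / ((k : ℝ) + 1)) ^ 2 := by
  have hB : 0 ≤ B := by
    have := h 1
    simp at this
    nlinarith [sq_nonneg (v 0)]
  set S : ℕ → ℝ := fun n => ∑ k ∈ Finset.range n, v k ^ 2 with hS
  -- Summation by parts. As `S (n + 1) ≤ B (n + 1)`, each increment is dominated by the telescoping
  -- `2B (1/(n+1) - 1/(n+2))`; this comes down to `2n + 3 ≤ 2n + 4`. The boundary term is at most
  -- `B`, whence the total `3B` below.
  have key : ∀ n : ℕ, ∑ k ∈ Finset.range n, (v k / ((k : ℝ) + 1)) ^ 2 ≤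
      S n / ((n : ℝ) + 1) ^ 2 + 2 * B * (1 - 1 / ((n : ℝ) + 1)) := by
    intro n
    induction n with
    | zero => simp [hS]
    | succ n ih =>
      have h1 : S (n + 1) = S n + v n ^ 2 := Finset.sum_range_succ _ _
      have h2 : S (n + 1) ≤ B * ((n : ℝ) + 1) := by simpa using h (n + 1)
      have h3 : S (n + 1) * (1 / ((n : ℝ) + 1) ^ 2 - 1 / ((n : ℝ) + 2) ^ 2) ≤
          2 * B * (1 / ((n : ℝ) + 1) - 1 / ((n : ℝ) + 2)) := by
        have e1 : 1 / ((n : ℝ) + 1) ^ 2 - 1 / ((n : ℝ) + 2) ^ 2 =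
            (2 * n + 3) / (((n : ℝ) + 1) ^ 2 * ((n : ℝ) + 2) ^ 2) := by
          field_simp; ring
        have e2 : 2 * B * (1 / ((n : ℝ) + 1) - 1 / ((n : ℝ) + 2)) =
            (B * ((n : ℝ) + 1)) * ((2 * n + 4) / (((n : ℝ) + 1) ^ 2 * ((n : ℝ) + 2) ^ 2)) := by
          field_simp; ring
        rw [e1, e2]
        refine mul_le_mul h2 ?_ (by positivity) (by positivity)
        gcongr
        norm_num
      rw [Finset.sum_range_succ]
      have e3 : (v n / ((n : ℝ) + 1)) ^ 2 = S (n + 1) * (1 / ((n : ℝ) + 1) ^ 2) -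
          S n / ((n : ℝ) + 1) ^ 2 := by
        rw [h1, div_pow]; ring
      have e4 : ((n + 1 : ℕ) : ℝ) + 1 = (n : ℝ) + 2 := by push_cast; ring
      have e5 : S (n + 1) / ((n : ℝ) + 2) ^ 2 = S (n + 1) * (1 / ((n : ℝ) + 2) ^ 2) := by ring
      rw [e3, e4, e5]
      linarith
  refine summable_of_sum_range_le (c := 3 * B) (fun k => sq_nonneg _) fun n => ?_
  refine (key n).trans ?_
  have h4 : S n / ((n : ℝ) + 1) ^ 2 ≤ B := by
    rw [div_le_iff₀ (by positivity)]
    refine (h n).trans ?_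
    gcongr
    nlinarith [(Nat.cast_nonneg n : (0 : ℝ) ≤ n)]
  have h5 : 0 ≤ 1 / ((n : ℝ) + 1) := by positivity
  nlinarith

/-! ### Recursive least squares -/

section LeastSquaresIdentities

variable {ι : Type*} [Fintype ι] [DecidableEq ι]

/-- A symmetric real matrix dominates its smallest eigenvalue. -/
theorem lamMin_mul_le_dotProduct {M : Matrix ι ι ℝ} (hM : M.IsHermitian) (x : ι → ℝ) :
    lamMin M * dotProduct x x ≤ dotProduct x (M.mulVec x) := by
  have hN : (M - lamMin M • (1 : Matrix ι ι ℝ)).IsHermitian := by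
    refine hM.sub ?_
    simp [Matrix.IsHermitian]
  have hbdd : BddBelow {μ : ℝ | Module.End.HasEigenvalue (Matrix.toLin' M) μ} :=
    (Module.End.finite_hasEigenvalue (Matrix.toLin' M)).bddBelow
  -- An eigenvalue of the shifted matrix becomes one of `M` after adding `lamMin M`, and the latter
  -- is a lower bound of a finite set of eigenvalues.
  have hpsd : (M - lamMin M • (1 : Matrix ι ι ℝ)).PosSemidef := by
    rw [hN.posSemidef_iff_eigenvalues_nonneg]
    intro i
    have h1 := hN.mulVec_eigenvectorBasis i
    set v : ι → ℝ := (hN.eigenvectorBasis i).ofLp with hv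
    have hv0 : v ≠ 0 := by
      intro h0
      have := hN.eigenvectorBasis.orthonormal.ne_zero i
      apply this
      ext j
      simpa using congrFun h0 j
    have h2 : M.mulVec v = (hN.eigenvalues i + lamMin M) • v := by
      rw [Matrix.sub_mulVec, Matrix.smul_mulVec, Matrix.one_mulVec, sub_eq_iff_eq_add] at h1
      rw [h1, add_smul]
    have h3 : Module.End.HasEigenvalue (Matrix.toLin' M) (hN.eigenvalues i + lamMin M) :=
      Module.End.hasEigenvalue_of_hasEigenvector (x := v)
        ⟨Module.End.mem_eigenspace_iff.2 (by rw [Matrix.toLin'_apply, h2]), hv0⟩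
    have h4 : lamMin M ≤ hN.eigenvalues i + lamMin M := csInf_le hbdd h3
    simpa using h4
  have := hpsd.dotProduct_mulVec_nonneg x
  rw [Matrix.sub_mulVec, Matrix.smul_mulVec, Matrix.one_mulVec, dotProduct_sub,
    dotProduct_smul] at this
  simpa using this

omit [Fintype ι] in
theorem isHermitian_infoMatrix (α : ℝ) (φ : ℕ → EuclideanSpace ℝ ι) (k : ℕ) :
    (infoMatrix α φ k).IsHermitian := by
  ext i j
  simp [infoMatrix, Matrix.sum_apply, Matrix.vecMulVec_apply, Matrix.one_apply, eq_comm, mul_comm]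

theorem infoMatrix_mulVec (α : ℝ) (φ : ℕ → EuclideanSpace ℝ ι) (k : ℕ) (x : ι → ℝ) :
    (infoMatrix α φ k).mulVec x =
      α • x + ∑ t ∈ Finset.range k, dotProduct (φ t).ofLp x • (φ t).ofLp := by
  rw [infoMatrix, Matrix.add_mulVec, Matrix.smul_mulVec, Matrix.one_mulVec, Matrix.sum_mulVec]
  congr 1
  refine Finset.sum_congr rfl fun t _ => ?_
  ext i
  simp [Matrix.vecMulVec_mulVec, mul_comm]

theorem dotProduct_infoMatrix_mulVec (α : ℝ) (φ : ℕ → EuclideanSpace ℝ ι) (k : ℕ) (x : ι → ℝ) :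
    dotProduct x ((infoMatrix α φ k).mulVec x) =
      α * dotProduct x x + ∑ t ∈ Finset.range k, dotProduct (φ t).ofLp x ^ 2 := by
  rw [infoMatrix_mulVec, dotProduct_add, dotProduct_smul, dotProduct_sum, smul_eq_mul]
  congr 1
  refine Finset.sum_congr rfl fun t _ => ?_
  rw [dotProduct_smul, dotProduct_comm x, smul_eq_mul, sq]

omit [Fintype ι] in
theorem infoMatrix_succ (α : ℝ) (φ : ℕ → EuclideanSpace ℝ ι) (k : ℕ) :
    infoMatrix α φ (k + 1) =
      infoMatrix α φ k + Matrix.vecMulVec (φ k).ofLp (φ k).ofLp := by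
  rw [infoMatrix, infoMatrix, Finset.sum_range_succ, add_assoc]

/-- With `Q` the information matrix and `x = R v` one has `Q x = v`, so `v ⬝ R v = x ⬝ Q x ≥ 0`.
Stated for any right inverse `R`, it is available inside the induction that identifies `rlsCov` as
such an inverse. -/
theorem one_add_dotProduct_pos {α : ℝ} (hα : 0 < α) (φ : ℕ → EuclideanSpace ℝ ι) (k : ℕ)
    {R : Matrix ι ι ℝ} (hR : infoMatrix α φ k * R = 1) (v : ι → ℝ) :
    0 < 1 + dotProduct v (R.mulVec v) := by
  have h1 : (infoMatrix α φ k).mulVec (R.mulVec v) = v := by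
    rw [Matrix.mulVec_mulVec, hR, Matrix.one_mulVec]
  have h2 := dotProduct_infoMatrix_mulVec α φ k (R.mulVec v)
  rw [h1, dotProduct_comm] at h2
  have h3 : 0 ≤ dotProduct (R.mulVec v) (R.mulVec v) :=
    Finset.sum_nonneg fun i _ => mul_self_nonneg _
  have h4 : 0 ≤ ∑ t ∈ Finset.range k, dotProduct (φ t).ofLp (R.mulVec v) ^ 2 :=
    Finset.sum_nonneg fun t _ => sq_nonneg _
  have := mul_nonneg hα.le h3
  linarith

/-- The covariance recursion inverts the information matrix (Sherman–Morrison). -/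
theorem infoMatrix_mul_rlsCov {α : ℝ} (hα : 0 < α) (φ : ℕ → EuclideanSpace ℝ ι) (k : ℕ) :
    infoMatrix α φ k * rlsCov α φ k = 1 := by
  induction k with
  | zero => simp [infoMatrix, rlsCov, hα.ne']
  | succ k ih =>
    have hpos := one_add_dotProduct_pos hα φ k ih (φ k).ofLp
    rw [infoMatrix_succ, rlsCov]
    set Q := infoMatrix α φ k
    set R := rlsCov α φ k
    set v := (φ k).ofLp
    set s := dotProduct v (R.mulVec v) with hs
    have h1 : Matrix.vecMulVec v v * R * Matrix.vecMulVec v v = s • Matrix.vecMulVec v v := by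
      rw [Matrix.mul_assoc, Matrix.mul_vecMulVec, Matrix.vecMulVec_mul_vecMulVec,
        Matrix.vecMulVec_smul]
    -- Since `(Q + v vᵀ) R = 1 + v vᵀ R`, the correction has to cancel `v vᵀ R`; the factor `1 + s`
    -- produced here is what the gain inverts.
    have h2 : (Q + Matrix.vecMulVec v v) * (R * Matrix.vecMulVec v v * R) =
        (1 + s) • (Matrix.vecMulVec v v * R) := by
      calc (Q + Matrix.vecMulVec v v) * (R * Matrix.vecMulVec v v * R)
          = (Q * R) * (Matrix.vecMulVec v v * R) +
            (Matrix.vecMulVec v v * R * Matrix.vecMulVec v v) * R := by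
            simp only [Matrix.add_mul, Matrix.mul_assoc]
        _ = _ := by rw [ih, h1, Matrix.one_mul, Matrix.smul_mul, add_smul, one_smul]
    change (Q + Matrix.vecMulVec v v) * (R - (1 + s)⁻¹ • (R * Matrix.vecMulVec v v * R)) = 1
    rw [Matrix.mul_sub, Matrix.mul_smul, h2, smul_smul, inv_mul_cancel₀ hpos.ne', one_smul,
      Matrix.add_mul, ih, add_sub_cancel_right]

/-- Normal equations of recursive least squares for the estimation error. -/
theorem infoMatrix_mulVec_error {α : ℝ} (hα : 0 < α) (θ θ₀ : EuclideanSpace ℝ ι)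
    (φ : ℕ → EuclideanSpace ℝ ι) (y : ℕ → ℝ) (k : ℕ) :
    (infoMatrix α φ k).mulVec (θ - rlsEstimate α θ₀ φ y k).ofLp =
      α • (θ - θ₀).ofLp - ∑ t ∈ Finset.range k,
        (y (t + 1) - dotProduct (φ t).ofLp θ.ofLp) • (φ t).ofLp := by
  induction k with
  | zero => simp [infoMatrix, rlsEstimate, Matrix.smul_mulVec]
  | succ k ih =>
    have hQR := infoMatrix_mul_rlsCov hα φ k
    have hpos := one_add_dotProduct_pos hα φ k hQR (φ k).ofLp
    rw [infoMatrix_succ, rlsEstimate, Finset.sum_range_succ, sub_add_eq_sub_sub (α • _),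
      ← ih]
    set Q := infoMatrix α φ k
    set R := rlsCov α φ k
    set θk := rlsEstimate α θ₀ φ y k
    set v := (φ k).ofLp
    set s := dotProduct v (R.mulVec v) with hs
    set c := y (k + 1) - dotProduct v θk.ofLp with hc
    -- The same factor cancels the gain, so the new information matrix applied to the correction of
    -- the estimate is exactly `c • v`.
    have h1 : (Q + Matrix.vecMulVec v v).mulVec (R.mulVec v) = (1 + s) • v := by
      rw [Matrix.add_mulVec, Matrix.mulVec_mulVec, hQR, Matrix.one_mulVec,
        Matrix.vecMulVec_mulVec, add_smul, one_smul, op_smul_eq_smul]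
    have h2 : (θ - (θk + ((1 + s)⁻¹ * c) • WithLp.toLp 2 (R.mulVec v))).ofLp =
        (θ - θk).ofLp - ((1 + s)⁻¹ * c) • R.mulVec v := by
      rw [← sub_sub]; rfl
    change (Q + Matrix.vecMulVec v v).mulVec
      (θ - (θk + ((1 + s)⁻¹ * c) • WithLp.toLp 2 (R.mulVec v))).ofLp = _
    rw [h2, Matrix.mulVec_sub, Matrix.mulVec_smul, h1, smul_smul, Matrix.add_mulVec,
      Matrix.vecMulVec_mulVec]
    have h3 : (1 + s)⁻¹ * c * (1 + s) = c := by field_simp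
    rw [h3]
    ext i
    simp only [WithLp.ofLp_sub, Pi.sub_apply, Pi.add_apply, Pi.smul_apply, smul_eq_mul,
      dotProduct_sub, MulOpposite.smul_eq_mul_unop, MulOpposite.unop_op, hc]
    ring

end LeastSquaresIdentities

/-- Solves `q² ≤ x d + q s` with `c x² ≤ q²`. -/
theorem le_of_sq_le_add {x q d s c : ℝ} (hd : 0 ≤ d) (hs : 0 ≤ s)
    (hc : 0 < c) (hq : 0 ≤ q) (h1 : c ^ 2 * x ^ 2 ≤ q ^ 2) (h2 : q ^ 2 ≤ x * d + q * s) :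
    x ≤ d / c ^ 2 + s / c := by
  have h3 : c * x ≤ q := by
    rw [← mul_pow] at h1
    exact le_of_sq_le_sq h1 hq
  rcases hq.eq_or_lt with h0 | h0
  · have : x ≤ 0 := by nlinarith
    exact this.trans (by positivity)
  have h4 : q ≤ d / c + s := by
    have : x ≤ q / c := by rw [le_div_iff₀ hc]; linarith
    have h5 : q * q ≤ q * (d / c + s) := by
      calc q * q ≤ x * d + q * s := by nlinarith
        _ ≤ q / c * d + q * s := by gcongr
        _ = q * (d / c + s) := by ring
    exact le_of_mul_le_mul_left h5 h0
  calc x ≤ (d / c + s) / c := by rw [le_div_iff₀ hc]; linarith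
    _ = _ := by field_simp

theorem sum_dotProduct_mul_dotProduct {ι : Type*} [Fintype ι] (f g : ℕ → EuclideanSpace ℝ ι)
    (n : ℕ) (x y : ι → ℝ) :
    ∑ k ∈ Finset.range n, dotProduct (f k).ofLp x * dotProduct (g k).ofLp y =
      ∑ i, ∑ j, x i * y j * ∑ k ∈ Finset.range n, f k i * g k j := by
  simp_rw [dotProduct, Finset.sum_mul_sum, Finset.mul_sum]
  rw [Finset.sum_comm]
  refine Finset.sum_congr rfl fun i _ => ?_
  rw [Finset.sum_comm]
  refine Finset.sum_congr rfl fun j _ => Finset.sum_congr rfl fun k _ => ?_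
  ring

theorem abs_quadratic_le {ι : Type*} [Fintype ι] (M : ι → ι → ℝ) {x : ι → ℝ} {r : ℝ}
    (hx : ∀ i, |x i| ≤ r) :
    |∑ i, ∑ j, x i * x j * M i j| ≤ r ^ 2 * ∑ i, ∑ j, |M i j| := by
  rw [Finset.mul_sum]
  refine (Finset.abs_sum_le_sum_abs _ _).trans (Finset.sum_le_sum fun i _ => ?_)
  rw [Finset.mul_sum]
  refine (Finset.abs_sum_le_sum_abs _ _).trans (Finset.sum_le_sum fun j _ => ?_)
  rw [abs_mul, abs_mul, sq]
  have := (abs_nonneg (x i)).trans (hx i)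
  gcongr
  exacts [hx i, hx j]

/-- Asymptotic error of recursive least squares with noisy regressors `φ + ζ`, when the empirical
covariances of the noises converge and those of the noises with the signals vanish. -/
theorem limsup_norm_rls_error_le {ι : Type*} [Fintype ι] [DecidableEq ι] {α : ℝ} (hα : 0 < α)
    (θ θ₀ : EuclideanSpace ℝ ι) (φ ζ : ℕ → EuclideanSpace ℝ ι) (y e : ℕ → ℝ)
    (hy : ∀ k, y (k + 1) = dotProduct (φ k).ofLp θ.ofLp + e k) (D : ι → ℝ) {γ d : ℝ}
    (hγ : 0 < γ) (hd : 0 ≤ d) (hD : ∀ i, d ≤ D i)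
    (hφζ : ∀ i j, Tendsto (fun n : ℕ => (n : ℝ)⁻¹ * ∑ k ∈ Finset.range n, φ k i * ζ k j)
      atTop (𝓝 0))
    (hζζ : ∀ i j, Tendsto (fun n : ℕ => (n : ℝ)⁻¹ * ∑ k ∈ Finset.range n, ζ k i * ζ k j)
      atTop (𝓝 (if i = j then 2 * D i else 0)))
    (he : ∀ i, Tendsto (fun n : ℕ => (n : ℝ)⁻¹ * ∑ k ∈ Finset.range n, (φ k i + ζ k i) * e k)
      atTop (𝓝 0))
    (hlim : (γ : EReal) < liminf (fun k : ℕ =>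
      ((lamMin (infoMatrix α φ k) / (k : ℝ) : ℝ) : EReal)) atTop) :
    limsup (fun k : ℕ => ((‖θ - rlsEstimate α θ₀ (fun t => φ t + ζ t) y k‖ : ℝ) : EReal)) atTop ≤
      ((√(2 * ∑ i, D i * θ i ^ 2) / √(γ + 2 * d) : ℝ) : EReal) := by
  set A : ℕ → ι → ι → ℝ := fun n i j => (n : ℝ)⁻¹ * ∑ k ∈ Finset.range n, φ k i * ζ k j with hA
  set B : ℕ → ι → ι → ℝ := fun n i j => (n : ℝ)⁻¹ * ∑ k ∈ Finset.range n, ζ k i * ζ k j with hB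
  set F : ℕ → ι → ℝ :=
    fun n i => (n : ℝ)⁻¹ * ∑ k ∈ Finset.range n, (φ k i + ζ k i) * e k with hF
  -- `E n` measures how far the cross and noise covariances are from their limit; in a quadratic
  -- form at `z` it costs at most `E n * ‖z‖ ^ 2`. Below, `dn` gathers the terms linear in `z` that
  -- vanish (initial value, correlation with `e`), and `sn` is the root mean square of `ζ k ⬝ θ`.
  set E : ℕ → ℝ := fun n => ∑ i, ∑ j, |2 * A n i j + B n i j - if i = j then 2 * D i else 0|
    with hE
  set Γ := γ + 2 * d with hΓ
  have hΓpos : 0 < Γ := by positivity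
  have hE0 : Tendsto E atTop (𝓝 0) := by
    have : Tendsto E atTop (𝓝 (∑ i : ι, ∑ j : ι, |2 * (0 : ℝ) + (if i = j then 2 * D i else 0) -
        if i = j then 2 * D i else 0|)) :=
      tendsto_finsetSum _ fun i _ => tendsto_finsetSum _ fun j _ =>
        ((((hφζ i j).const_mul 2).add (hζζ i j)).sub_const _).abs
    simpa using this
  set dn : ℕ → ℝ := fun n => (n : ℝ)⁻¹ * (α * ‖θ - θ₀‖) + ∑ i, |F n i| with hdn
  have hdn0 : Tendsto dn atTop (𝓝 0) := by
    have h1 : Tendsto (fun n : ℕ => (n : ℝ)⁻¹ * (α * ‖θ - θ₀‖)) atTop (𝓝 (0 * (α * ‖θ - θ₀‖))) :=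
      tendsto_inv_atTop_nhds_zero_nat.mul_const _
    have h2 : Tendsto (fun n => ∑ i, |F n i|) atTop (𝓝 (∑ _i : ι, |(0 : ℝ)|)) :=
      tendsto_finsetSum _ fun i _ => (he i).abs
    simpa using h1.add h2
  set sn : ℕ → ℝ := fun n => √(∑ i, ∑ j, θ i * θ j * B n i j) with hsn
  have hsn0 : Tendsto sn atTop (𝓝 √(2 * ∑ i, D i * θ i ^ 2)) := by
    refine (Real.continuous_sqrt.tendsto _).comp ?_
    have : Tendsto (fun n => ∑ i, ∑ j, θ i * θ j * B n i j) atTop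
        (𝓝 (∑ i, ∑ j, θ i * θ j * (if i = j then 2 * D i else 0))) :=
      tendsto_finsetSum _ fun i _ => tendsto_finsetSum _ fun j _ => (hζζ i j).const_mul _
    convert this using 2
    rw [Finset.mul_sum]
    refine Finset.sum_congr rfl fun i _ => ?_
    simp
    ring
  have hbound : ∀ᶠ n in atTop, ‖θ - rlsEstimate α θ₀ (fun t => φ t + ζ t) y n‖ ≤
      dn n / √(Γ - E n) ^ 2 + sn n / √(Γ - E n) := by
    have hev := eventually_lt_of_lt_liminf hlim
    have hEv : ∀ᶠ n in atTop, E n < Γ := hE0.eventually_lt_const hΓpos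
    filter_upwards [hev, hEv, eventually_gt_atTop 0] with n h1 h2 hn
    have hn' : (0 : ℝ) < n := by exact_mod_cast hn
    have h1' : γ < lamMin (infoMatrix α φ n) / n := by exact_mod_cast h1
    rw [lt_div_iff₀ hn'] at h1'
    set z := θ - rlsEstimate α θ₀ (fun t => φ t + ζ t) y n with hz
    set x : ι → ℝ := z.ofLp with hx
    have hnorm : dotProduct x x = ‖z‖ ^ 2 := by
      rw [EuclideanSpace.real_norm_sq_eq]
      simp [dotProduct, hx, sq]
    have hxi : ∀ i, |x i| ≤ ‖z‖ := fun i => PiLp.norm_apply_le z i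
    set Q := dotProduct x ((infoMatrix α (fun t => φ t + ζ t) n).mulVec x) with hQ
    have hQ1 : Q = α * dotProduct x x +
        ∑ t ∈ Finset.range n, dotProduct (φ t + ζ t).ofLp x ^ 2 :=
      dotProduct_infoMatrix_mulVec _ _ _ _
    -- Expansion of `(φ k ⬝ x + ζ k ⬝ x)²`; the pure signal part, with `α`, is the noise-free
    -- information matrix, to which the excitation bound applies.
    have hsplit : Q = dotProduct x ((infoMatrix α φ n).mulVec x) +
        n * ∑ i, ∑ j, x i * x j * (2 * A n i j + B n i j) := by
      have e1 : n * ∑ i, ∑ j, x i * x j * (2 * A n i j + B n i j) =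
          2 * (∑ k ∈ Finset.range n, dotProduct (φ k).ofLp x * dotProduct (ζ k).ofLp x) +
          ∑ k ∈ Finset.range n, dotProduct (ζ k).ofLp x * dotProduct (ζ k).ofLp x := by
        rw [sum_dotProduct_mul_dotProduct, sum_dotProduct_mul_dotProduct, Finset.mul_sum,
          Finset.mul_sum, ← Finset.sum_add_distrib]
        refine Finset.sum_congr rfl fun i _ => ?_
        rw [Finset.mul_sum, Finset.mul_sum, ← Finset.sum_add_distrib]
        refine Finset.sum_congr rfl fun j _ => ?_
        simp only [hA, hB]
        field_simp
      rw [hQ1, dotProduct_infoMatrix_mulVec, e1, add_assoc, Finset.mul_sum,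
        ← Finset.sum_add_distrib, ← Finset.sum_add_distrib]
      congr 1
      refine Finset.sum_congr rfl fun k _ => ?_
      rw [WithLp.ofLp_add, add_dotProduct]
      ring
    have hquad : 2 * d * ‖z‖ ^ 2 - ‖z‖ ^ 2 * E n ≤
        ∑ i, ∑ j, x i * x j * (2 * A n i j + B n i j) := by
      have e1 := (abs_le.1 (abs_quadratic_le
        (fun i j => 2 * A n i j + B n i j - if i = j then 2 * D i else 0) hxi)).1
      have e2 : ∑ i, ∑ j, x i * x j * (2 * A n i j + B n i j - if i = j then 2 * D i else 0) =
          ∑ i, ∑ j, x i * x j * (2 * A n i j + B n i j) - ∑ i, 2 * D i * (x i * x i) := by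
        rw [← Finset.sum_sub_distrib]
        refine Finset.sum_congr rfl fun i _ => ?_
        simp_rw [mul_sub]
        rw [Finset.sum_sub_distrib]
        simp only [mul_ite, mul_zero, Finset.sum_ite_eq, Finset.mem_univ, if_true]
        ring
      have e3 : 2 * d * ‖z‖ ^ 2 ≤ ∑ i, 2 * D i * (x i * x i) := by
        rw [← hnorm, dotProduct, Finset.mul_sum]
        refine Finset.sum_le_sum fun i _ => ?_
        have := hD i
        have := mul_self_nonneg (x i)
        gcongr
      rw [e2] at e1
      linarith
    have hlow : (Γ - E n) * ‖z‖ ^ 2 ≤ (n : ℝ)⁻¹ * Q := by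
      have e1 := lamMin_mul_le_dotProduct (isHermitian_infoMatrix α φ n) x
      rw [hnorm] at e1
      have e2 : γ * n * ‖z‖ ^ 2 ≤ dotProduct x ((infoMatrix α φ n).mulVec x) :=
        le_trans (by gcongr) e1
      have e3 : (n : ℝ) * ((Γ - E n) * ‖z‖ ^ 2) ≤ Q := by
        rw [hsplit]
        have := mul_le_mul_of_nonneg_left hquad hn'.le
        simp only [hΓ]
        linarith
      rw [inv_mul_eq_div, le_div_iff₀ hn']
      linarith
    have hQ0 : 0 ≤ (n : ℝ)⁻¹ * Q :=
      le_trans (mul_nonneg (by linarith) (sq_nonneg _)) hlow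
    have hB0 : ∑ i, ∑ j, θ i * θ j * B n i j =
        (n : ℝ)⁻¹ * ∑ k ∈ Finset.range n, dotProduct (ζ k).ofLp θ.ofLp ^ 2 := by
      simp_rw [sq]
      rw [sum_dotProduct_mul_dotProduct, Finset.mul_sum]
      refine Finset.sum_congr rfl fun i _ => ?_
      rw [Finset.mul_sum]
      refine Finset.sum_congr rfl fun j _ => ?_
      simp only [hB]
      ring
    -- The normal equations tested against the error. The residual at the true parameter is `e k - ζ
    -- k ⬝ θ`, so the errors in the regressors enter through the last sum of `e1`.
    have hupper : (n : ℝ)⁻¹ * Q ≤ ‖z‖ * dn n + √((n : ℝ)⁻¹ * Q) * sn n := by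
      have e1 : Q = α * dotProduct x (θ - θ₀).ofLp
          - ∑ k ∈ Finset.range n, e k * dotProduct (φ k + ζ k).ofLp x
          + ∑ k ∈ Finset.range n, dotProduct (ζ k).ofLp θ.ofLp * dotProduct (φ k + ζ k).ofLp x := by
        rw [hQ, hx, hz, infoMatrix_mulVec_error hα, dotProduct_sub, dotProduct_smul, smul_eq_mul,
          dotProduct_sum, sub_add, ← Finset.sum_sub_distrib]
        congr 1
        refine Finset.sum_congr rfl fun k _ => ?_
        rw [dotProduct_smul, hy, smul_eq_mul, dotProduct_comm _ (φ k + ζ k).ofLp]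
        have : dotProduct (φ k + ζ k).ofLp θ.ofLp =
            dotProduct (φ k).ofLp θ.ofLp + dotProduct (ζ k).ofLp θ.ofLp := by
          rw [WithLp.ofLp_add, add_dotProduct]
        rw [this]
        ring
      have e2 : (n : ℝ)⁻¹ * ∑ k ∈ Finset.range n, e k * dotProduct (φ k + ζ k).ofLp x =
          ∑ i, x i * F n i := by
        simp only [hF, dotProduct, Finset.mul_sum]
        rw [Finset.sum_comm]
        refine Finset.sum_congr rfl fun i _ => Finset.sum_congr rfl fun k _ => ?_
        simp only [PiLp.add_apply]
        ring
      have e3 : |∑ i, x i * F n i| ≤ ‖z‖ * ∑ i, |F n i| := by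
        rw [Finset.mul_sum]
        refine (Finset.abs_sum_le_sum_abs _ _).trans (Finset.sum_le_sum fun i _ => ?_)
        rw [abs_mul]
        gcongr
        exact hxi i
      have e4 : dotProduct x (θ - θ₀).ofLp ≤ ‖z‖ * ‖θ - θ₀‖ := by
        have := real_inner_le_norm z (θ - θ₀)
        rwa [EuclideanSpace.inner_eq_star_dotProduct, dotProduct_comm] at this
      -- Cauchy–Schwarz keeps `√(Q / n)` on the right instead of estimating it by `‖z‖`. One factor
      -- of it then cancels against the left-hand side, and no upper bound on the signals enters.
      have e5 : (n : ℝ)⁻¹ * ∑ k ∈ Finset.range n,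
          dotProduct (ζ k).ofLp θ.ofLp * dotProduct (φ k + ζ k).ofLp x ≤
          √((n : ℝ)⁻¹ * Q) * sn n := by
        simp only [hsn]
        rw [hB0, ← Real.sqrt_mul hQ0]
        refine Real.le_sqrt_of_sq_le ?_
        have cs := Finset.sum_mul_sq_le_sq_mul_sq (Finset.range n)
          (fun k => dotProduct (ζ k).ofLp θ.ofLp) (fun k => dotProduct (φ k + ζ k).ofLp x)
        have hle : ∑ k ∈ Finset.range n, dotProduct (φ k + ζ k).ofLp x ^ 2 ≤ Q := by
          rw [hQ1, hnorm]
          have : 0 ≤ α * ‖z‖ ^ 2 := by positivity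
          linarith
        have h0 : 0 ≤ ∑ k ∈ Finset.range n, dotProduct (ζ k).ofLp θ.ofLp ^ 2 :=
          Finset.sum_nonneg fun _ _ => sq_nonneg _
        calc _ = ((n : ℝ)⁻¹) ^ 2 * (∑ k ∈ Finset.range n,
              dotProduct (ζ k).ofLp θ.ofLp * dotProduct (φ k + ζ k).ofLp x) ^ 2 := by ring
          _ ≤ ((n : ℝ)⁻¹) ^ 2 * ((∑ k ∈ Finset.range n, dotProduct (ζ k).ofLp θ.ofLp ^ 2) *
              Q) := by gcongr; exact cs.trans (by gcongr)
          _ = _ := by ring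
      have e6 : (n : ℝ)⁻¹ * (α * dotProduct x (θ - θ₀).ofLp) ≤
          ‖z‖ * ((n : ℝ)⁻¹ * (α * ‖θ - θ₀‖)) := by
        calc (n : ℝ)⁻¹ * (α * dotProduct x (θ - θ₀).ofLp)
            ≤ (n : ℝ)⁻¹ * (α * (‖z‖ * ‖θ - θ₀‖)) := by gcongr
          _ = _ := by ring
      have e7 := (abs_le.1 e3).1
      have e8 : (n : ℝ)⁻¹ * Q = (n : ℝ)⁻¹ * (α * dotProduct x (θ - θ₀).ofLp) - ∑ i, x i * F n i +
          (n : ℝ)⁻¹ * ∑ k ∈ Finset.range n,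
            dotProduct (ζ k).ofLp θ.ofLp * dotProduct (φ k + ζ k).ofLp x := by
        rw [← e2, ← mul_sub, ← mul_add, ← e1]
      have e9 : ‖z‖ * dn n = ‖z‖ * ((n : ℝ)⁻¹ * (α * ‖θ - θ₀‖)) + ‖z‖ * ∑ i, |F n i| := by
        simp only [hdn, mul_add]
      rw [e9]
      linarith
    refine le_of_sq_le_add (q := √((n : ℝ)⁻¹ * Q)) ?_ (Real.sqrt_nonneg _)
      (Real.sqrt_pos.2 (by linarith)) (Real.sqrt_nonneg _) ?_ ?_
    · exact add_nonneg (by positivity) (Finset.sum_nonneg fun _ _ => abs_nonneg _)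
    · rw [Real.sq_sqrt hQ0, Real.sq_sqrt (by linarith)]
      exact hlow
    · rw [Real.sq_sqrt hQ0]
      exact hupper
  have hlimit : Tendsto (fun n => dn n / √(Γ - E n) ^ 2 + sn n / √(Γ - E n)) atTop
      (𝓝 (√(2 * ∑ i, D i * θ i ^ 2) / √Γ)) := by
    have h1 : Tendsto (fun n => √(Γ - E n)) atTop (𝓝 √Γ) := by
      have h := (Real.continuous_sqrt.tendsto (Γ - 0)).comp (hE0.const_sub Γ)
      rwa [sub_zero] at h
    have h2 : √Γ ≠ 0 := (Real.sqrt_pos.2 hΓpos).ne'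
    have := (hdn0.div (h1.pow 2) (pow_ne_zero 2 h2)).add (hsn0.div h1 h2)
    simpa using this
  -- In `EReal` the limsup is monotone without any boundedness condition.
  have hlimit' : Tendsto (fun n => ((dn n / √(Γ - E n) ^ 2 + sn n / √(Γ - E n) : ℝ) : EReal)) atTop
      (𝓝 ((√(2 * ∑ i, D i * θ i ^ 2) / √Γ : ℝ) : EReal)) :=
    (continuous_coe_real_ereal.tendsto _).comp hlimit
  rw [← hlimit'.limsup_eq]
  refine limsup_le_limsup ?_
  filter_upwards [hbound] with n hn
  exact EReal.coe_le_coe_iff.2 hn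

/-! ### Shifts of Laplace distributions -/

theorem measurable_laplaceDensity (b : ℝ) :
    Measurable fun x : ℝ => ENNReal.ofReal (1 / (2 * b) * Real.exp (-|x| / b)) := by
  fun_prop

theorem integral_abs_pow_mul_laplaceDensity {b : ℝ} (hb : 0 < b) (n : ℕ) :
    ∫ x : ℝ, |x| ^ n * (1 / (2 * b) * Real.exp (-|x| / b)) = b ^ n * n.factorial := by
  rw [integral_comp_abs (f := fun r : ℝ => r ^ n * (1 / (2 * b) * Real.exp (-r / b)))]
  have h := Real.integral_rpow_mul_exp_neg_mul_Ioi (a := n + 1) (r := 1 / b) (by positivity)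
    (by positivity)
  have h2 : ∫ r in Set.Ioi (0 : ℝ), r ^ n * (1 / (2 * b) * Real.exp (-r / b)) =
      1 / (2 * b) * ∫ t in Set.Ioi (0 : ℝ), t ^ ((n : ℝ) + 1 - 1) * Real.exp (-(1 / b * t)) := by
    rw [← integral_const_mul]
    refine integral_congr_ae (ae_of_all _ fun r => ?_)
    simp only [add_sub_cancel_right, Real.rpow_natCast]
    have : -r / b = -(1 / b * r) := by ring
    rw [this]
    ring
  rw [h2, h, Real.Gamma_nat_eq_factorial]
  have : (1 / (1 / b)) ^ ((n : ℝ) + 1) = b ^ (n + 1) := by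
    rw [one_div_one_div, ← Real.rpow_natCast]; norm_num
  rw [this, pow_succ]
  field_simp

/-- A non-integrable function has integral zero by convention, whereas the value just computed is
positive. -/
theorem integrable_abs_pow_mul_laplaceDensity {b : ℝ} (hb : 0 < b) (n : ℕ) :
    Integrable fun x : ℝ => |x| ^ n * (1 / (2 * b) * Real.exp (-|x| / b)) := by
  by_contra h
  have h1 := integral_abs_pow_mul_laplaceDensity hb n
  rw [integral_undef h] at h1
  have : 0 < b ^ n * (n.factorial : ℝ) := by positivity
  linarith

theorem lintegral_abs_pow_laplaceMeasure {b : ℝ} (hb : 0 < b) (n : ℕ) :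
    ∫⁻ x, ENNReal.ofReal (|x| ^ n) ∂(laplaceMeasure b) =
      ENNReal.ofReal (b ^ n * n.factorial) := by
  rw [laplaceMeasure, lintegral_withDensity_eq_lintegral_mul _ (measurable_laplaceDensity b)
    (by fun_prop), ← integral_abs_pow_mul_laplaceDensity hb n,
    ofReal_integral_eq_lintegral_ofReal (integrable_abs_pow_mul_laplaceDensity hb n)
      (ae_of_all _ fun x => by positivity)]
  refine lintegral_congr fun x => ?_
  rw [Pi.mul_apply, mul_comm, ← ENNReal.ofReal_mul (by positivity)]

theorem isProbabilityMeasure_laplaceMeasure {b : ℝ} (hb : 0 < b) :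
    IsProbabilityMeasure (laplaceMeasure b) := by
  refine ⟨?_⟩
  have := lintegral_abs_pow_laplaceMeasure hb 0
  simpa using this

/-- After translation invariance of Lebesgue measure the densities are compared pointwise: `|x - c'|
≤ |x - c| + |c - c'|` bounds their ratio. -/
theorem laplaceMeasure_map_add_le {b : ℝ} (hb : 0 < b) (c c' : ℝ) :
    (laplaceMeasure b).map (fun x => c + x) ≤
      ENNReal.ofReal (Real.exp (|c - c'| / b)) • (laplaceMeasure b).map (fun x => c' + x) := by
  have hmap : ∀ a : ℝ, ∀ s, MeasurableSet s → (laplaceMeasure b).map (fun x => a + x) s =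
      ∫⁻ x in s, ENNReal.ofReal (1 / (2 * b) * Real.exp (-|x - a| / b)) := by
    intro a s hs
    rw [Measure.map_apply (measurable_const_add a) hs, laplaceMeasure,
      withDensity_apply _ (measurable_const_add a hs),
      ← lintegral_indicator (measurable_const_add a hs), ← lintegral_indicator hs,
      ← lintegral_add_left_eq_self (μ := (volume : Measure ℝ)) (Set.indicator s _) a]
    refine lintegral_congr fun x => ?_
    have h1 : a + x - a = x := by ring
    by_cases hx : a + x ∈ s
    · rw [Set.indicator_of_mem hx, Set.indicator_of_mem (show x ∈ (fun x => a + x) ⁻¹' s from hx),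
        h1]
    · rw [Set.indicator_of_notMem hx,
        Set.indicator_of_notMem (show x ∉ (fun x => a + x) ⁻¹' s from hx)]
  refine Measure.le_iff.2 fun s hs => ?_
  rw [Measure.smul_apply, hmap c s hs, hmap c' s hs, smul_eq_mul,
    ← lintegral_const_mul _ (by fun_prop)]
  refine lintegral_mono fun x => ?_
  rw [← ENNReal.ofReal_mul (Real.exp_pos _).le]
  refine ENNReal.ofReal_le_ofReal ?_
  rw [mul_left_comm, ← Real.exp_add]
  gcongr
  rw [← add_div]
  gcongr
  have := abs_sub_abs_le_abs_sub (x - c') (x - c)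
  have h2 : x - c' - (x - c) = c - c' := by ring
  rw [h2] at this
  linarith

/-- The product measure of the `ν i` comes from the largest outer measure bounded on boxes by the
product of the `ν i`, and `Measure.pi μ` satisfies that bound. -/
theorem measure_pi_mono {ι : Type*} [Fintype ι] {μ ν : ι → Measure ℝ} [∀ i, SigmaFinite (μ i)]
    [∀ i, SigmaFinite (ν i)] (h : ∀ i, μ i ≤ ν i) : Measure.pi μ ≤ Measure.pi ν := by
  refine Measure.le_iff.2 fun s hs => ?_
  rw [Measure.pi_def ν, toMeasure_apply _ _ hs]
  have h1 : (Measure.pi μ).toOuterMeasure ≤ OuterMeasure.pi fun i => (ν i).toOuterMeasure := by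
    rw [OuterMeasure.le_pi]
    intro t _
    change Measure.pi μ _ ≤ _
    rw [Measure.pi_pi]
    exact Finset.prod_le_prod' fun i _ => h i _
  exact h1 s

theorem laplace_pi_map_add_le {ι : Type*} [Fintype ι] {b : ι → ℝ} (hb : ∀ i, 0 < b i)
    (c c' : ι → ℝ) :
    (Measure.pi fun i => laplaceMeasure (b i)).map (fun x => c + x) ≤
      ENNReal.ofReal (Real.exp (∑ i, |c i - c' i| / b i)) •
        (Measure.pi fun i => laplaceMeasure (b i)).map (fun x => c' + x) := by
  have : ∀ i, IsProbabilityMeasure (laplaceMeasure (b i)) := fun i =>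
    isProbabilityMeasure_laplaceMeasure (hb i)
  have hprob : ∀ (a : ℝ) (i : ι),
      IsProbabilityMeasure ((laplaceMeasure (b i)).map fun x => a + x) := fun a i =>
    Measure.isProbabilityMeasure_map (measurable_const_add a).aemeasurable
  have hpi : ∀ a : ι → ℝ, (Measure.pi fun i => laplaceMeasure (b i)).map (fun x => a + x) =
      Measure.pi fun i => (laplaceMeasure (b i)).map fun x => a i + x := fun a => by
    have := fun i => hprob (a i) i
    exact Measure.pi_map_pi (f := fun i x => a i + x) fun i => (measurable_const_add _).aemeasurable
  have := fun i => hprob (c i) i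
  have := fun i => hprob (c' i) i
  have hsf : ∀ i, IsFiniteMeasure (ENNReal.ofReal (Real.exp (|c i - c' i| / b i)) •
      (laplaceMeasure (b i)).map fun x => c' i + x) := fun i =>
    Measure.smul_finite _ ENNReal.ofReal_ne_top
  rw [hpi, hpi]
  refine (measure_pi_mono fun i => laplaceMeasure_map_add_le (hb i) (c i) (c' i)).trans
    (le_of_eq (Measure.pi_eq fun s _ => ?_))
  rw [Measure.smul_apply, Measure.pi_pi, smul_eq_mul, Real.exp_sum,
    ENNReal.ofReal_prod_of_nonneg fun i _ => (Real.exp_pos _).le, ← Finset.prod_mul_distrib]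
  rfl

/-- Adding independent Laplace noise to statistics of bounded sensitivity is differentially
private. -/
theorem measure_add_laplace_le {Ω ι Y : Type*} [MeasurableSpace Ω] [Fintype ι] [MeasurableSpace Y]
    {P : Measure Ω} [IsProbabilityMeasure P] {b : ι → ℝ} (hb : ∀ i, 0 < b i) {Z V V' : Ω → ι → ℝ}
    (hZ : Measurable Z) (hV : Measurable V) (hV' : Measurable V')
    (hlaw : P.map Z = Measure.pi fun i => laplaceMeasure (b i))
    (hind : IndepFun Z (fun ω => (V ω, V' ω)) P) {ε : ℝ}
    (hsens : ∀ ω, ∑ i, |V ω i - V' ω i| / b i ≤ ε) {g : (ι → ℝ) → Y} (hg : Measurable g)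
    {D : Set Y} (hD : MeasurableSet D) :
    P {ω | g (V ω + Z ω) ∈ D} ≤
      ENNReal.ofReal (Real.exp ε) * P {ω | g (V' ω + Z ω) ∈ D} := by
  have : ∀ i, IsProbabilityMeasure (laplaceMeasure (b i)) := fun i =>
    isProbabilityMeasure_laplaceMeasure (hb i)
  set ν := Measure.pi fun i => laplaceMeasure (b i) with hν
  set μ := P.map fun ω => (V ω, V' ω) with hμ
  have hVV : Measurable fun ω => (V ω, V' ω) := hV.prodMk hV'
  have : IsProbabilityMeasure μ := Measure.isProbabilityMeasure_map hVV.aemeasurable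
  have hprod : P.map (fun ω => ((V ω, V' ω), Z ω)) = μ.prod ν := by
    rw [(indepFun_iff_map_prod_eq_prod_map_map hVV.aemeasurable hZ.aemeasurable).1 hind.symm, hlaw]
  have hVVZ : Measurable fun ω => ((V ω, V' ω), Z ω) := hVV.prodMk hZ
  -- Fubini, by independence: for a frozen value `v` of the pair of statistics the release has a
  -- translated noise law. Taking the pair puts both probabilities over the same `μ`, so they can be
  -- compared pointwise in `v`.
  have key : ∀ W : (ι → ℝ) × (ι → ℝ) → ι → ℝ, Measurable W →
      P {ω | g (W (V ω, V' ω) + Z ω) ∈ D} =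
        ∫⁻ v, (ν.map (fun x => W v + x)) (g ⁻¹' D) ∂μ := by
    intro W hW
    have hm : Measurable fun p : ((ι → ℝ) × (ι → ℝ)) × (ι → ℝ) => g (W p.1 + p.2) :=
      hg.comp ((hW.comp measurable_fst).add measurable_snd)
    have h1 : P {ω | g (W (V ω, V' ω) + Z ω) ∈ D} =
        P.map (fun ω => ((V ω, V' ω), Z ω)) ((fun p => g (W p.1 + p.2)) ⁻¹' D) := by
      rw [Measure.map_apply hVVZ (hm hD)]; rfl
    rw [h1, hprod, Measure.prod_apply (hm hD)]
    refine lintegral_congr fun v => ?_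
    rw [Measure.map_apply (measurable_const_add _) (hg hD)]
    rfl
  have e1 := key Prod.fst measurable_fst
  have e2 := key Prod.snd measurable_snd
  simp only at e1 e2
  rw [e1, e2, ← lintegral_const_mul']
  · refine lintegral_mono_ae ?_
    have hset : MeasurableSet {v : (ι → ℝ) × (ι → ℝ) | ∑ i, |v.1 i - v.2 i| / b i ≤ ε} :=
      measurableSet_le (by fun_prop) measurable_const
    have : ∀ᵐ v ∂μ, ∑ i, |v.1 i - v.2 i| / b i ≤ ε :=
      (ae_map_iff hVV.aemeasurable hset).2 (ae_of_all _ hsens)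
    filter_upwards [this] with v hv
    refine (laplace_pi_map_add_le hb v.1 v.2 _).trans ?_
    rw [Measure.smul_apply, smul_eq_mul]
    gcongr
  · exact ENNReal.ofReal_ne_top

/-! ### Sensitivity of the system output -/

namespace ARXModel

variable {m : ℕ} (S : ARXModel m)

/-- Output of the autonomous system in companion form. -/
def readout (z : EuclideanSpace ℝ (Fin S.p)) : ℝ := ∑ j, S.a j * z j.rev

/-- The companion matrix as an operator. -/
def companionCLM : EuclideanSpace ℝ (Fin S.p) →L[ℝ] EuclideanSpace ℝ (Fin S.p) :=
  Matrix.toEuclideanCLM (𝕜 := ℝ) S.companion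

/-- State vector `[d_{k-p+1}, …, d_k]`. -/
def state (d : ℕ → ℝ) (k : ℕ) : EuclideanSpace ℝ (Fin S.p) :=
  WithLp.toLp 2 fun i => lag d k i.rev

/-- Input vector of the companion form. -/
def inputVec : EuclideanSpace ℝ (Fin S.p) :=
  WithLp.toLp 2 fun i => if (i : ℕ) + 1 = S.p then 1 else 0

theorem companionCLM_apply (z : EuclideanSpace ℝ (Fin S.p)) (i : Fin S.p) :
    S.companionCLM z i = if (i : ℕ) + 1 = S.p then S.readout z else
      if h : (i : ℕ) + 1 < S.p then z ⟨i + 1, h⟩ else 0 := by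
  have h0 : S.companionCLM z i = ∑ j, S.companion i j * z j := rfl
  rw [h0]
  split_ifs with h1 h2
  · rw [readout, ← Equiv.sum_comp Fin.revPerm]
    refine Finset.sum_congr rfl fun j _ => ?_
    simp [companion, h1]
  · rw [Finset.sum_eq_single ⟨i + 1, h2⟩]
    · simp [companion, h1]
    · intro j _ hj
      have : (j : ℕ) ≠ i + 1 := fun h => hj (Fin.ext h)
      simp [companion, h1, this]
    · simp
  · exact absurd (lt_of_le_of_ne i.isLt h1) h2

theorem state_succ {d g : ℕ → ℝ} {k : ℕ}
    (hd : d (k + 1) = ∑ j : Fin S.p, S.a j * lag d k j + g k) :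
    S.state d (k + 1) = S.companionCLM (S.state d k) + g k • S.inputVec := by
  ext i
  rw [PiLp.add_apply, companionCLM_apply, PiLp.smul_apply]
  simp only [state, inputVec, readout, Fin.rev_rev, smul_eq_mul]
  have hrev : ((i.rev : Fin S.p) : ℕ) = S.p - (i + 1) := Fin.val_rev i
  split_ifs with h1 h2
  · have h4 : S.p - ((i : ℕ) + 1) = 0 := by omega
    rw [hrev, h4, lag]
    simpa using hd
  · have h3 : ((⟨i + 1, h2⟩ : Fin S.p).rev : ℕ) = S.p - (i + 1 + 1) := Fin.val_rev _
    have h4 : S.p - ((i : ℕ) + 1) = S.p - (i + 1 + 1) + 1 := by omega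
    rw [hrev, h3, h4, lag, lag, mul_zero, add_zero]
    simp
  · exact absurd (lt_of_le_of_ne i.isLt h1) h2

theorem companionCLM_pow (j : ℕ) :
    S.companionCLM ^ j = Matrix.toEuclideanCLM (𝕜 := ℝ) (S.companion ^ j) :=
  (map_pow _ _ _).symm

/-- The readout is the last row of the companion matrix, so it equals the last coordinate of the
next power applied to `z`; this accounts for the exponent `j + 1`. The factor `√p ≥ 1` only serves
to match the stated constant. -/
theorem abs_readout_pow_le {c₀ lam : ℝ} (hA : S.CompanionBound c₀ lam) (j : ℕ)
    (z : EuclideanSpace ℝ (Fin S.p)) :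
    |S.readout ((S.companionCLM ^ j) z)| ≤ √(S.p : ℝ) * (c₀ * lam ^ (j + 1)) * ‖z‖ := by
  rcases Nat.eq_zero_or_pos S.p with h0 | hpos
  · have : IsEmpty (Fin S.p) := by rw [h0]; infer_instance
    simp [readout, h0]
  have hlast : S.p - 1 + 1 = S.p := by omega
  have h1 : S.readout ((S.companionCLM ^ j) z) =
      (S.companionCLM ^ (j + 1)) z ⟨S.p - 1, by omega⟩ := by
    rw [pow_succ', mul_apply_eq_comp, companionCLM_apply, if_pos hlast]
  have h2 : ‖(S.companionCLM ^ (j + 1)) z‖ ≤ c₀ * lam ^ (j + 1) * ‖z‖ := by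
    refine (ContinuousLinearMap.le_opNorm _ _).trans ?_
    gcongr
    rw [companionCLM_pow]
    exact hA (j + 1)
  have h3 : 1 ≤ √(S.p : ℝ) := Real.one_le_sqrt.2 (by exact_mod_cast hpos)
  have h4 : 0 ≤ c₀ * lam ^ (j + 1) * ‖z‖ := (norm_nonneg _).trans h2
  rw [h1, mul_assoc]
  exact (PiLp.norm_apply_le _ _).trans (h2.trans (le_mul_of_one_le_left h4 h3))

/-- Total absolute output of the autonomous system started at `z`. -/
def freeResponse (z : EuclideanSpace ℝ (Fin S.p)) : ℝ :=
  ∑' j : ℕ, |S.readout ((S.companionCLM ^ j) z)|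

section FreeResponse

variable {S} {c₀ lam : ℝ}

theorem hasSum_freeResponse_bound (hlam0 : 0 < lam) (hlam1 : lam < 1)
    (z : EuclideanSpace ℝ (Fin S.p)) :
    HasSum (fun j : ℕ => √(S.p : ℝ) * (c₀ * lam ^ (j + 1)) * ‖z‖)
      (√(S.p : ℝ) * c₀ * lam / (1 - lam) * ‖z‖) := by
  have := (hasSum_geometric_of_lt_one hlam0.le hlam1).mul_left (√(S.p : ℝ) * c₀ * lam * ‖z‖)
  have e1 : √(S.p : ℝ) * c₀ * lam * ‖z‖ * (1 - lam)⁻¹ =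
      √(S.p : ℝ) * c₀ * lam / (1 - lam) * ‖z‖ := by ring
  rw [e1] at this
  refine this.congr_fun fun j => ?_
  ring

theorem summable_freeResponse (hA : S.CompanionBound c₀ lam) (hlam0 : 0 < lam) (hlam1 : lam < 1)
    (z : EuclideanSpace ℝ (Fin S.p)) :
    Summable fun j : ℕ => |S.readout ((S.companionCLM ^ j) z)| :=
  Summable.of_nonneg_of_le (fun _ => abs_nonneg _) (fun j => S.abs_readout_pow_le hA j z)
    (hasSum_freeResponse_bound hlam0 hlam1 z).summable

theorem freeResponse_nonneg (z : EuclideanSpace ℝ (Fin S.p)) : 0 ≤ S.freeResponse z :=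
  tsum_nonneg fun _ => abs_nonneg _

theorem freeResponse_le (hA : S.CompanionBound c₀ lam) (hlam0 : 0 < lam) (hlam1 : lam < 1)
    (z : EuclideanSpace ℝ (Fin S.p)) :
    S.freeResponse z ≤ √(S.p : ℝ) * c₀ * lam / (1 - lam) * ‖z‖ :=
  (hasSum_freeResponse_bound hlam0 hlam1 z).tsum_eq ▸
    (summable_freeResponse hA hlam0 hlam1 z).tsum_le_tsum (fun j => S.abs_readout_pow_le hA j z)
      (hasSum_freeResponse_bound hlam0 hlam1 z).summable

theorem freeResponse_add_le (hA : S.CompanionBound c₀ lam) (hlam0 : 0 < lam) (hlam1 : lam < 1)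
    (z z' : EuclideanSpace ℝ (Fin S.p)) :
    S.freeResponse (z + z') ≤ S.freeResponse z + S.freeResponse z' := by
  have h1 := summable_freeResponse hA hlam0 hlam1 z
  have h2 := summable_freeResponse hA hlam0 hlam1 z'
  rw [freeResponse, freeResponse, freeResponse, ← h1.tsum_add h2]
  refine (summable_freeResponse hA hlam0 hlam1 _).tsum_le_tsum (fun j => ?_) (h1.add h2)
  rw [map_add]
  have : S.readout ((S.companionCLM ^ j) z + (S.companionCLM ^ j) z') =
      S.readout ((S.companionCLM ^ j) z) + S.readout ((S.companionCLM ^ j) z') := by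
    simp [readout, mul_add, Finset.sum_add_distrib]
  rw [this]
  exact abs_add_le _ _

/-- Splitting off the first term of the series: one autonomous step spends exactly the output it
produces, so `freeResponse` acts as a storage function. -/
theorem abs_readout_add_freeResponse (hA : S.CompanionBound c₀ lam) (hlam0 : 0 < lam)
    (hlam1 : lam < 1) (z : EuclideanSpace ℝ (Fin S.p)) :
    |S.readout z| + S.freeResponse (S.companionCLM z) = S.freeResponse z := by
  rw [freeResponse, freeResponse, (summable_freeResponse hA hlam0 hlam1 z).tsum_eq_zero_add]
  simp [pow_succ]

theorem norm_inputVec_le : ‖S.inputVec‖ ≤ 1 := by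
  rw [← sq_le_one_iff₀ (norm_nonneg _), EuclideanSpace.real_norm_sq_eq]
  simp only [inputVec, ite_pow, one_pow, ne_eq, OfNat.ofNat_ne_zero, not_false_eq_true, zero_pow,
    Finset.sum_boole]
  norm_cast
  refine Finset.card_le_one.2 fun i hi j hj => ?_
  simp only [Finset.mem_filter, Finset.mem_univ, true_and] at hi hj
  exact Fin.ext (by omega)

/-- Total variation of the output of the system driven by `g` from time `T` on. -/
theorem sum_abs_output_le (hA : S.CompanionBound c₀ lam) (hlam0 : 0 < lam) (hlam1 : lam < 1)
    (hc₀ : 0 < c₀) {d g : ℕ → ℝ} {T : ℕ}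
    (hd : ∀ k, T ≤ k → d (k + 1) = ∑ j : Fin S.p, S.a j * lag d k j + g k) {n : ℕ} (hn : T ≤ n) :
    ∑ k ∈ Finset.Ico T n, |d (k + 1)| + S.freeResponse (S.state d n) ≤
      S.freeResponse (S.state d T) + S.privacyConstOutput c₀ lam *
        ∑ k ∈ Finset.Ico T n, |g k| := by
  induction n, hn using Nat.le_induction with
  | base => simp
  | succ n hn ih =>
    rw [Finset.sum_Ico_succ_top hn, Finset.sum_Ico_succ_top hn]
    have h1 : d (n + 1) = S.readout (S.state d n) + g n := by
      rw [hd n hn]; simp only [readout, state, Fin.rev_rev]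
    -- One step: the autonomous part is paid for by the storage function, and the forcing `g n`
    -- costs `|g n|` directly plus the free response it triggers later. Together these give the
    -- constant `1 + √p c₀ lam / (1 - lam)`.
    have h2 := freeResponse_add_le hA hlam0 hlam1 (S.companionCLM (S.state d n))
      (g n • S.inputVec)
    rw [← S.state_succ (hd n hn)] at h2
    have h3 := freeResponse_le hA hlam0 hlam1 (g n • S.inputVec)
    have h4 : ‖g n • S.inputVec‖ ≤ |g n| := by
      rw [norm_smul, Real.norm_eq_abs]
      exact mul_le_of_le_one_right (abs_nonneg _) norm_inputVec_le
    have hK : 0 ≤ √(S.p : ℝ) * c₀ * lam / (1 - lam) := by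
      have : 0 < 1 - lam := by linarith
      positivity
    have h5 := mul_le_mul_of_nonneg_left h4 hK
    have h6 := abs_readout_add_freeResponse hA hlam0 hlam1 (S.state d n)
    have h7 : |d (n + 1)| ≤ |S.readout (S.state d n)| + |g n| := h1 ▸ abs_add_le _ _
    rw [privacyConstOutput] at ih ⊢
    linarith

/-- The ℓ² norm is at most the ℓ¹ norm, and the state only contains values among `d 1, …, d T` and
zeros; `d 0 = 0` is needed for the lag equal to `T`. -/
theorem norm_state_le {d : ℕ → ℝ} (hd : d 0 = 0) (T : ℕ) :
    ‖S.state d T‖ ≤ ∑ k ∈ Finset.range T, |d (k + 1)| := by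
  have h1 : ‖S.state d T‖ ≤ ∑ i, |S.state d T i| := by
    refine le_of_sq_le_sq ?_ (Finset.sum_nonneg fun _ _ => abs_nonneg _)
    rw [EuclideanSpace.real_norm_sq_eq]
    refine le_trans (le_of_eq ?_) (Finset.sum_sq_le_sq_sum_of_nonneg fun _ _ => abs_nonneg _)
    simp
  refine h1.trans ?_
  have h2 : ∑ i, |S.state d T i| = ∑ j ∈ Finset.range S.p, |lag d T j| := by
    rw [← Fin.sum_univ_eq_sum_range (fun j => |lag d T j|), ← Equiv.sum_comp Fin.revPerm]
    simp only [state, Fin.revPerm_apply, Fin.rev_rev]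
  have h3 : ∀ j, T ≤ j → |lag d T j| = 0 := by
    intro j hj
    rw [lag]
    split_ifs with h
    · rw [le_antisymm h hj, Nat.sub_self, hd, abs_zero]
    · exact abs_zero
  have h4 : ∑ j ∈ Finset.range S.p, |lag d T j| ≤ ∑ j ∈ Finset.range T, |lag d T j| := by
    rw [← Finset.sum_filter_of_ne (p := fun j => j < T)
      fun j _ hne => not_le.1 fun h => hne (h3 j h)]
    refine Finset.sum_le_sum_of_subset_of_nonneg (fun j hj => ?_) fun _ _ _ => abs_nonneg _
    exact Finset.mem_range.2 (Finset.mem_filter.1 hj).2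
  rw [h2]
  refine h4.trans (le_of_eq ?_)
  rw [← Finset.sum_range_reflect]
  refine Finset.sum_congr rfl fun j hj => ?_
  have := Finset.mem_range.1 hj
  rw [lag, if_pos (by omega)]
  congr 2
  omega

end FreeResponse

theorem output_zero (T : ℕ) (x : Fin T → ℝ) (u : Fin m → ℕ → ℝ) (w : ℕ → ℝ) :
    S.output T x u w 0 = 0 := by
  rw [output]

theorem output_succ_of_lt {T : ℕ} (x : Fin T → ℝ) (u : Fin m → ℕ → ℝ) (w : ℕ → ℝ) {k : ℕ}
    (h : k < T) : S.output T x u w (k + 1) = x ⟨k, h⟩ := by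
  rw [output, dif_pos h]

theorem output_succ_of_le {T : ℕ} (x : Fin T → ℝ) (u : Fin m → ℕ → ℝ) (w : ℕ → ℝ) {k : ℕ}
    (h : T ≤ k) : S.output T x u w (k + 1) = S.drift (S.output T x u w) u k + w (k + 1) := by
  rw [output, dif_neg (by omega)]
  congr 1
  unfold drift
  congr 1
  -- `lag` at time `k` only reads times up to `k`, so the truncation in the recursive definition has
  -- no effect.
  refine Finset.sum_congr rfl fun j _ => ?_
  simp [lag]

theorem lag_sub (x x' : ℕ → ℝ) (k j : ℕ) :
    lag (fun n => x n - x' n) k j = lag x k j - lag x' k j := by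
  unfold lag
  split_ifs <;> simp

theorem sum_abs_lag_le (e : ℕ → ℝ) (l n : ℕ) :
    ∑ k ∈ Finset.range n, |lag e k l| ≤ ∑ k ∈ Finset.range n, |e k| := by
  have h1 : ∑ k ∈ Finset.range n, |lag e k l| = ∑ k ∈ Finset.Ico l n, |e (k - l)| := by
    rw [← Finset.sum_filter_of_ne (p := fun k => l ≤ k)
      fun k _ hne => not_lt.1 fun h => hne (by simp [lag, h])]
    have : (Finset.range n).filter (fun k => l ≤ k) = Finset.Ico l n := by
      ext k; simp [and_comm]
    rw [this]
    refine Finset.sum_congr rfl fun k hk => ?_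
    rw [lag, if_pos (Finset.mem_Ico.1 hk).1]
  rw [h1, Finset.sum_Ico_eq_sum_range]
  simp only [Nat.add_sub_cancel_left]
  exact Finset.sum_le_sum_of_subset_of_nonneg (Finset.range_mono (Nat.sub_le n l))
    fun _ _ _ => abs_nonneg _

theorem sum_abs_extend {T n : ℕ} (h : T ≤ n) (e : ℕ → ℝ) (x x' : Fin T → ℝ)
    (he : ∀ (k : ℕ) (hk : k < T), e k = x ⟨k, hk⟩ - x' ⟨k, hk⟩) (he' : ∀ k, T ≤ k → e k = 0) :
    ∑ k ∈ Finset.range n, |e k| = l1Dist x x' := by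
  rw [← Finset.sum_range_add_sum_Ico _ h, Finset.sum_eq_zero (s := Finset.Ico T n), add_zero,
    ← Fin.sum_univ_eq_sum_range (fun k => |e k|), l1Dist]
  · exact Finset.sum_congr rfl fun k _ => by rw [he k k.2]
  · intro k hk
    rw [he' k (Finset.mem_Ico.1 hk).1, abs_zero]

/-- Sensitivity of the outputs with respect to prescribed initial outputs. -/
theorem sum_abs_output_sub_le {c₀ lam : ℝ} (hA : S.CompanionBound c₀ lam) (hlam0 : 0 < lam)
    (hlam1 : lam < 1) (hc₀ : 0 < c₀) {T n : ℕ} (hn : T ≤ n) (x x' : Fin T → ℝ)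
    (u : Fin m → ℕ → ℝ) (w : ℕ → ℝ) :
    ∑ k ∈ Finset.range n, |S.output T x u w (k + 1) - S.output T x' u w (k + 1)| ≤
      S.privacyConstOutput c₀ lam * l1Dist x x' := by
  set d : ℕ → ℝ := fun k => S.output T x u w k - S.output T x' u w k with hd
  have hd0 : d 0 = 0 := by simp [hd, output_zero]
  have hstep : ∀ k, T ≤ k → d (k + 1) = ∑ j : Fin S.p, S.a j * lag d k j + (fun _ => (0 : ℝ)) k := by
    intro k hk
    simp only [hd, lag_sub, S.output_succ_of_le _ _ _ hk, drift, mul_sub, Finset.sum_sub_distrib]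
    ring
  -- From time `T` on there is no forcing. The first `T` outputs contribute `l1Dist x x'`
  -- themselves, and the state they leave behind contributes the rest of the constant.
  have h1 := sum_abs_output_le hA hlam0 hlam1 hc₀ hstep hn
  simp only [abs_zero, Finset.sum_const_zero, mul_zero, add_zero] at h1
  have h2 := freeResponse_le hA hlam0 hlam1 (S.state d T)
  have h3 := norm_state_le (S := S) hd0 T
  have h4 : ∑ k ∈ Finset.range T, |d (k + 1)| = l1Dist x x' := by
    rw [← Fin.sum_univ_eq_sum_range (fun k => |d (k + 1)|), l1Dist]
    refine Finset.sum_congr rfl fun k _ => ?_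
    simp only [hd, S.output_succ_of_lt _ _ _ k.2]
  have hK : 0 ≤ √(S.p : ℝ) * c₀ * lam / (1 - lam) := by
    have : 0 < 1 - lam := by linarith
    positivity
  have h5 := mul_le_mul_of_nonneg_left h3 hK
  have h6 := freeResponse_nonneg (S.state d n)
  change ∑ k ∈ Finset.range n, |d (k + 1)| ≤ _
  rw [← Finset.sum_range_add_sum_Ico _ hn, privacyConstOutput]
  rw [h4] at h5 ⊢
  linarith

/-- Sensitivity of the outputs with respect to prescribed initial inputs of one participant. -/
theorem sum_abs_output_replaceInput_sub_le {c₀ lam : ℝ} (hA : S.CompanionBound c₀ lam)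
    (hlam0 : 0 < lam) (hlam1 : lam < 1) (hc₀ : 0 < c₀) {T n : ℕ} (hn : T ≤ n) (i : Fin m)
    (x x' : Fin T → ℝ) (u : Fin m → ℕ → ℝ) (w : ℕ → ℝ) :
    ∑ k ∈ Finset.range n, |S.output 0 Fin.elim0 (replaceInput i T x u) w (k + 1) -
        S.output 0 Fin.elim0 (replaceInput i T x' u) w (k + 1)| ≤
      S.privacyConstInput c₀ lam i * l1Dist x x' := by
  set v := replaceInput i T x u with hv
  set v' := replaceInput i T x' u with hv'
  set d : ℕ → ℝ := fun k => S.output 0 Fin.elim0 v w k - S.output 0 Fin.elim0 v' w k with hd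
  set e : ℕ → ℝ := fun k => v i k - v' i k with he
  set g : ℕ → ℝ := fun k => ∑ l : Fin (S.q i), S.coefU i l * lag e k l with hg
  have hd0 : d 0 = 0 := by simp [hd, output_zero]
  have hother : ∀ i', i' ≠ i → v i' = v' i' := fun i' h => by
    simp [hv, hv', replaceInput, Function.update_of_ne h]
  have hstep : ∀ k, 0 ≤ k → d (k + 1) = ∑ j : Fin S.p, S.a j * lag d k j + g k := by
    intro k hk
    have h1 : ∑ i', ∑ l : Fin (S.q i'), S.coefU i' l * lag (v i') k l -
        ∑ i', ∑ l : Fin (S.q i'), S.coefU i' l * lag (v' i') k l = g k := by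
      rw [← Finset.sum_sub_distrib, Finset.sum_eq_single i]
      · simp only [hg, he, lag_sub, mul_sub, Finset.sum_sub_distrib]
      · intro i' _ h
        rw [hother i' h, sub_self]
      · simp
    rw [← h1]
    simp only [hd, lag_sub, S.output_succ_of_le _ _ _ hk, drift, mul_sub, Finset.sum_sub_distrib]
    ring
  have h1 := sum_abs_output_le hA hlam0 hlam1 hc₀ hstep (Nat.zero_le n)
  -- Both trajectories start from the zero state, so only the forcing by the changed inputs matters.
  have h0 : S.freeResponse (S.state d 0) ≤ 0 := by
    refine (freeResponse_le hA hlam0 hlam1 _).trans (le_of_eq ?_)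
    have := norm_state_le (S := S) hd0 0
    rw [le_antisymm (this.trans (by simp)) (norm_nonneg _), mul_zero]
  have h2 : ∑ k ∈ Finset.range n, |e k| = l1Dist x x' := by
    refine sum_abs_extend hn e x x' (fun k hk => ?_) (fun k hk => ?_)
    · simp [he, hv, hv', replaceInput, hk]
    · simp [he, hv, hv', replaceInput, not_lt.2 hk]
  have h3 : ∑ k ∈ Finset.range n, |g k| ≤ (∑ l, |S.coefU i l|) * l1Dist x x' := by
    calc ∑ k ∈ Finset.range n, |g k|
        ≤ ∑ k ∈ Finset.range n, ∑ l : Fin (S.q i), |S.coefU i l| * |lag e k l| := by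
          refine Finset.sum_le_sum fun k _ => (Finset.abs_sum_le_sum_abs _ _).trans ?_
          simp [abs_mul]
      _ = ∑ l : Fin (S.q i), |S.coefU i l| * ∑ k ∈ Finset.range n, |lag e k l| := by
          rw [Finset.sum_comm]
          simp [Finset.mul_sum]
      _ ≤ ∑ l : Fin (S.q i), |S.coefU i l| * l1Dist x x' := by
          rw [← h2]
          exact Finset.sum_le_sum fun l _ =>
            mul_le_mul_of_nonneg_left (sum_abs_lag_le e l n) (abs_nonneg _)
      _ = _ := by rw [Finset.sum_mul]
  have h6 := freeResponse_nonneg (S.state d n)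
  rw [Nat.Ico_zero_eq_range] at h1
  have hK : 0 ≤ S.privacyConstOutput c₀ lam := by
    have : 0 < 1 - lam := by linarith
    rw [privacyConstOutput]
    positivity
  have h7 := mul_le_mul_of_nonneg_left h3 hK
  change ∑ k ∈ Finset.range n, |d (k + 1)| ≤ _
  have h8 : S.privacyConstInput c₀ lam i * l1Dist x x' =
      S.privacyConstOutput c₀ lam * ((∑ l, |S.coefU i l|) * l1Dist x x') := by
    rw [privacyConstInput, privacyConstOutput]; ring
  rw [h8]
  linarith

end ARXModel

/-! ### Differential privacy of the mechanisms -/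

theorem measurable_lag {Ω : Type*} [MeasurableSpace Ω] {x : ℕ → Ω → ℝ} {k : ℕ}
    (hx : ∀ n ≤ k, Measurable (x n)) (j : ℕ) : Measurable fun ω => lag (fun n => x n ω) k j := by
  unfold lag
  split_ifs
  · exact hx _ (Nat.sub_le k j)
  · exact measurable_const

namespace ARXModel

variable {m : ℕ} (S : ARXModel m)

theorem measurable_drift {Ω : Type*} [MeasurableSpace Ω] {y : ℕ → Ω → ℝ} {u : Fin m → ℕ → Ω → ℝ}
    {k : ℕ} (hy : ∀ n ≤ k, Measurable (y n)) (hu : ∀ i n, Measurable (u i n)) :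
    Measurable fun ω => S.drift (fun n => y n ω) (fun i n => u i n ω) k := by
  unfold drift
  refine Measurable.add (Finset.measurable_sum _ fun j _ => ?_)
    (Finset.measurable_sum _ fun i _ => Finset.measurable_sum _ fun l _ => ?_)
  · exact (measurable_lag hy j).const_mul _
  · exact (measurable_lag (fun n _ => hu i n) l).const_mul _

theorem measurable_output {Ω : Type*} [MeasurableSpace Ω] (T : ℕ) (x : Fin T → ℝ)
    {u : Fin m → ℕ → Ω → ℝ} (hu : ∀ i n, Measurable (u i n)) {w : ℕ → Ω → ℝ}
    (hw : ∀ n, Measurable (w (n + 1))) (k : ℕ) :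
    Measurable fun ω => S.output T x (fun i n => u i n ω) (fun n => w n ω) k := by
  induction k using Nat.strong_induction_on with
  | _ k ih =>
    rcases k with _ | k
    · simp only [output_zero]; exact measurable_const
    · rcases lt_or_ge k T with h | h
      · simp only [S.output_succ_of_lt _ _ _ h]; exact measurable_const
      · simp only [S.output_succ_of_le _ _ _ h]
        exact (S.measurable_drift
          (y := fun n ω => S.output T x (fun i n => u i n ω) (fun n => w n ω) n)
          (fun n hn => ih n (Nat.lt_succ_of_le hn)) hu).add (hw k)

theorem IsOutput.measurable {Ω : Type*} [MeasurableSpace Ω] {S : ARXModel m} {y : ℕ → Ω → ℝ}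
    {u : Fin m → ℕ → Ω → ℝ} {w : ℕ → Ω → ℝ}
    (hy : ∀ ω, S.IsOutput (fun k => y k ω) (fun i k => u i k ω) (fun k => w k ω))
    (hu : ∀ i n, Measurable (u i n)) (hw : ∀ n, Measurable (w (n + 1))) (k : ℕ) :
    Measurable (y k) := by
  induction k using Nat.strong_induction_on with
  | _ k ih =>
    rcases k with _ | k
    · have : y 0 = fun _ => 0 := funext fun ω => (hy ω).1
      rw [this]; exact measurable_const
    · have : y (k + 1) = fun ω => S.drift (fun n => y n ω) (fun i n => u i n ω) k + w (k + 1) ω :=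
        funext fun ω => (hy ω).2 k
      rw [this]
      exact (S.measurable_drift (fun n hn => ih n (Nat.lt_succ_of_le hn)) hu).add (hw k)

end ARXModel

namespace PrivacyNoise

variable {Ω : Type*} [mΩ : MeasurableSpace Ω] {P : Measure Ω} [IsProbabilityMeasure P] {m : ℕ}
  {b : Fin (m + 1) → ℝ} {η : ℕ → Ω → ℝ} {ξ : Fin m → ℕ → Ω → ℝ}
  {y : ℕ → Ω → ℝ} {u : Fin m → ℕ → Ω → ℝ} {w : ℕ → Ω → ℝ}

/-- The processes `y`, `u`, `w` as a single random variable. -/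
abbrev signal (y : ℕ → Ω → ℝ) (u : Fin m → ℕ → Ω → ℝ) (w : ℕ → Ω → ℝ) (ω : Ω) :
    (ℕ → ℝ) × (Fin m → ℕ → ℝ) × (ℕ → ℝ) :=
  (fun k => y k ω, fun i k => u i k ω, fun k => w (k + 1) ω)

/-- The privacy noises as a single random variable. -/
abbrev noise (η : ℕ → Ω → ℝ) (ξ : Fin m → ℕ → Ω → ℝ) (ω : Ω) : (ℕ → ℝ) × (Fin m → ℕ → ℝ) :=
  (fun k => η (k + 1) ω, fun i k => ξ i k ω)

/-- The σ-algebra of the processes `y`, `u`, `w`. -/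
abbrev signalAlgebra (y : ℕ → Ω → ℝ) (u : Fin m → ℕ → Ω → ℝ) (w : ℕ → Ω → ℝ) :
    MeasurableSpace Ω :=
  MeasurableSpace.comap (signal y u w) inferInstance

/-- The σ-algebra of the privacy noises. -/
abbrev noiseAlgebra (η : ℕ → Ω → ℝ) (ξ : Fin m → ℕ → Ω → ℝ) : MeasurableSpace Ω :=
  MeasurableSpace.comap (noise η ξ) inferInstance

omit mΩ in
theorem measurable_signal_y (k : ℕ) : Measurable[signalAlgebra y u w] (y k) :=
  (measurable_pi_apply k).comp (measurable_fst.comp (comap_measurable (signal y u w)))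

omit mΩ in
theorem measurable_signal_u (i : Fin m) (k : ℕ) : Measurable[signalAlgebra y u w] (u i k) :=
  (measurable_pi_apply k).comp ((measurable_pi_apply i).comp
    (measurable_fst.comp (measurable_snd.comp (comap_measurable (signal y u w)))))

omit mΩ in
theorem measurable_signal_w (k : ℕ) : Measurable[signalAlgebra y u w] (w (k + 1)) :=
  (measurable_pi_apply k).comp (measurable_snd.comp (measurable_snd.comp
    (comap_measurable (signal y u w))))

omit mΩ in
theorem measurable_noise_eta (k : ℕ) : Measurable[noiseAlgebra η ξ] (η (k + 1)) :=
  (measurable_pi_apply k).comp (measurable_fst.comp (comap_measurable (noise η ξ)))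

omit mΩ in
theorem measurable_noise_xi (i : Fin m) (k : ℕ) : Measurable[noiseAlgebra η ξ] (ξ i k) :=
  (measurable_pi_apply k).comp ((measurable_pi_apply i).comp
    (measurable_snd.comp (comap_measurable (noise η ξ))))

theorem signalAlgebra_le (hy : ∀ k, Measurable (y k)) (hu : ∀ i k, Measurable (u i k))
    (hw : ∀ k, Measurable (w (k + 1))) : signalAlgebra y u w ≤ mΩ :=
  Measurable.comap_le ((measurable_pi_lambda _ hy).prodMk
    ((measurable_pi_lambda _ fun i => measurable_pi_lambda _ (hu i)).prodMk
      (measurable_pi_lambda _ hw)))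

omit [IsProbabilityMeasure P] in
theorem indep_noise_signal (h : PrivacyNoise P b η ξ y u w) :
    Indep (noiseAlgebra η ξ) (signalAlgebra y u w) P := h.indep

omit [IsProbabilityMeasure P] in
theorem indepFun_of_measurable {α β : Type*} [mα : MeasurableSpace α] [mβ : MeasurableSpace β]
    (h : PrivacyNoise P b η ξ y u w) {Z : Ω → α} {V : Ω → β}
    (hZ : Measurable[noiseAlgebra η ξ] Z) (hV : Measurable[signalAlgebra y u w] V) :
    IndepFun Z V P :=
  indep_of_indep_of_le_left (indep_of_indep_of_le_right h.indep_noise_signal hV.comap_le)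
    hZ.comap_le

/-- The privacy noises as a single family. -/
abbrev family (η : ℕ → Ω → ℝ) (ξ : Fin m → ℕ → Ω → ℝ) : ℕ ⊕ (Fin m × ℕ) → Ω → ℝ :=
  Sum.elim (fun k => η (k + 1)) (fun ik => ξ ik.1 ik.2)

/-- Scales of the family of privacy noises. -/
def scale (b : Fin (m + 1) → ℝ) : ℕ ⊕ (Fin m × ℕ) → ℝ :=
  Sum.elim (fun _ => b 0) (fun ik => b ik.1.succ)

omit [IsProbabilityMeasure P] in
theorem measurable_family (h : PrivacyNoise P b η ξ y u w) (s : ℕ ⊕ (Fin m × ℕ)) :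
    Measurable (family η ξ s) := by
  rcases s with k | ⟨i, k⟩
  · exact h.measurable_eta _
  · exact h.measurable_xi _ _

omit mΩ in
theorem measurable_noise_family (s : ℕ ⊕ (Fin m × ℕ)) :
    Measurable[noiseAlgebra η ξ] (family η ξ s) := by
  rcases s with k | ⟨i, k⟩
  · exact measurable_noise_eta k
  · exact measurable_noise_xi i k

omit [IsProbabilityMeasure P] in
theorem law_family (h : PrivacyNoise P b η ξ y u w) (s : ℕ ⊕ (Fin m × ℕ)) :
    P.map (family η ξ s) = laplaceMeasure (scale b s) := by
  rcases s with k | ⟨i, k⟩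
  · exact h.law_eta _
  · exact h.law_xi _ _

/-- Statistics of the signals of bounded sensitivity, released with privacy noises. -/
theorem measure_release_le (h : PrivacyNoise P b η ξ y u w) (hb : ∀ i, 0 < b i)
    {ι Y : Type*} [Fintype ι] [MeasurableSpace Y] {f : ι → ℕ ⊕ (Fin m × ℕ)}
    (hf : Function.Injective f) {V V' : Ω → ι → ℝ} (hle : signalAlgebra y u w ≤ mΩ)
    (hV : Measurable[signalAlgebra y u w] V) (hV' : Measurable[signalAlgebra y u w] V')
    {ε : ℝ} (hsens : ∀ ω, ∑ i, |V ω i - V' ω i| / scale b (f i) ≤ ε) {g : (ι → ℝ) → Y}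
    (hg : Measurable g) {D : Set Y} (hD : MeasurableSet D) :
    P {ω | g (V ω + fun i => family η ξ (f i) ω) ∈ D} ≤
      ENNReal.ofReal (Real.exp ε) * P {ω | g (V' ω + fun i => family η ξ (f i) ω) ∈ D} := by
  have hZ : Measurable[noiseAlgebra η ξ] fun ω i => family η ξ (f i) ω :=
    @measurable_pi_lambda _ _ _ (noiseAlgebra η ξ) _ _ fun i => measurable_noise_family (f i)
  have hscale : ∀ i, 0 < scale b (f i) := by
    intro i
    rcases f i with k | ⟨j, k⟩
    exacts [hb 0, hb j.succ]
  refine measure_add_laplace_le hscale (measurable_pi_lambda _ fun i => h.measurable_family (f i))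
    (hV.mono hle le_rfl) (hV'.mono hle le_rfl) ?_
    (h.indepFun_of_measurable hZ (hV.prodMk hV')) hsens hg hD
  -- Injectivity of `f` ensures that distinct coordinates use distinct noises, so their joint law is
  -- a product.
  rw [(h.iIndep.precomp hf).map_fun_eq_pi_map fun i => (h.measurable_family (f i)).aemeasurable]
  congr 1
  ext1 i
  exact h.law_family (f i)

end PrivacyNoise

theorem measurable_replaceInput {Ω : Type*} [MeasurableSpace Ω] {m : ℕ} {u : Fin m → ℕ → Ω → ℝ}
    (hu : ∀ i k, Measurable (u i k)) (i : Fin m) (T : ℕ) (x : Fin T → ℝ) (j : Fin m) (k : ℕ) :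
    Measurable fun ω => ARXModel.replaceInput i T x (fun j n => u j n ω) j k := by
  unfold ARXModel.replaceInput
  by_cases hj : j = i
  · subst hj
    simp only [Function.update_self]
    split_ifs
    · exact measurable_const
    · exact hu _ _
  · simp only [Function.update_of_ne hj]
    exact hu _ _

section Mechanisms

variable {Ω : Type*} [mΩ : MeasurableSpace Ω] {P : Measure Ω} [IsProbabilityMeasure P] {m : ℕ}
  {S : ARXModel m} {b : Fin (m + 1) → ℝ} {η : ℕ → Ω → ℝ} {ξ : Fin m → ℕ → Ω → ℝ}
  {y : ℕ → Ω → ℝ} {u : Fin m → ℕ → Ω → ℝ} {w : ℕ → Ω → ℝ}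

open PrivacyNoise

theorem isDifferentiallyPrivate_outputMechanism (h : PrivacyNoise P b η ξ y u w)
    (hb : ∀ i, 0 < b i) (hle : signalAlgebra y u w ≤ mΩ) {ε δ c₀ lam : ℝ} (hc₀ : 0 < c₀)
    (hlam0 : 0 < lam) (hlam1 : lam < 1) (hA : S.CompanionBound c₀ lam)
    (hb0 : S.privacyConstOutput c₀ lam / b 0 * δ ≤ ε) {T₁ T₂ : ℕ} (hT : T₁ ≤ T₂) :
    IsDifferentiallyPrivate P l1Dist (S.outputMechanism u w η T₁ T₂) ε δ := by
  intro x x' hx D hD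
  -- Measurability is needed for the signal σ-algebra, not merely the ambient one, since this is
  -- what gives independence from the noises.
  have hmeas : ∀ x : Fin T₁ → ℝ, Measurable[signalAlgebra y u w] fun ω (k : Fin T₂) =>
      S.output T₁ x (fun i n => u i n ω) (fun n => w n ω) (k + 1) := fun x =>
    @measurable_pi_lambda _ _ _ (signalAlgebra y u w) _ _ fun k =>
      @ARXModel.measurable_output _ S _ (signalAlgebra y u w) T₁ x u measurable_signal_u w
        measurable_signal_w (k + 1)
  refine h.measure_release_le hb (f := fun k : Fin T₂ => Sum.inl (k : ℕ))
    (fun k k' hk => Fin.ext (Sum.inl_injective hk)) hle (hmeas x) (hmeas x') (fun ω => ?_)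
    measurable_id hD
  simp only [scale, Sum.elim_inl]
  rw [← Finset.sum_div]
  rw [Fin.sum_univ_eq_sum_range (fun k => |S.output T₁ x (fun i n => u i n ω) (fun n => w n ω)
    (k + 1) - S.output T₁ x' (fun i n => u i n ω) (fun n => w n ω) (k + 1)|)]
  have h1 := S.sum_abs_output_sub_le hA hlam0 hlam1 hc₀ hT x x' (fun i n => u i n ω)
    (fun n => w n ω)
  have hK : 0 ≤ S.privacyConstOutput c₀ lam := by
    have : 0 < 1 - lam := by linarith
    rw [ARXModel.privacyConstOutput]
    positivity
  refine le_trans ?_ hb0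
  rw [div_mul_eq_mul_div]
  have := hb 0
  gcongr
  exact h1.trans (by gcongr)

theorem isDifferentiallyPrivate_inputMechanism (h : PrivacyNoise P b η ξ y u w)
    (hb : ∀ i, 0 < b i) (hle : signalAlgebra y u w ≤ mΩ) {ε δ c₀ lam : ℝ} (hc₀ : 0 < c₀)
    (hlam0 : 0 < lam) (hlam1 : lam < 1) (hA : S.CompanionBound c₀ lam) {i : Fin m}
    (hbi : (S.privacyConstInput c₀ lam i / b 0 + 1 / b i.succ) * δ ≤ ε)
    {T₁ T₂ : ℕ} (hT : T₁ ≤ T₂) :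
    IsDifferentiallyPrivate P l1Dist (S.inputMechanism u w η ξ i T₁ T₂) ε δ := by
  intro x x' hx D hD
  -- Outputs and inputs are stacked into one vector, so that the two privacy losses add up in a
  -- single sensitivity sum.
  set V : (Fin T₁ → ℝ) → Ω → Fin T₂ ⊕ Fin T₂ → ℝ := fun x ω => Sum.elim
    (fun k => S.output 0 Fin.elim0 (ARXModel.replaceInput i T₁ x fun j n => u j n ω)
      (fun n => w n ω) (k + 1))
    (fun k => ARXModel.replaceInput i T₁ x (fun j n => u j n ω) i k) with hVdef
  have hrep : ∀ x j k, Measurable[signalAlgebra y u w] fun ω =>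
      ARXModel.replaceInput i T₁ x (fun j n => u j n ω) j k := fun x j k =>
    @measurable_replaceInput _ (signalAlgebra y u w) _ u measurable_signal_u i T₁ x j k
  have hmeas : ∀ x : Fin T₁ → ℝ, Measurable[signalAlgebra y u w] (V x) := fun x =>
    @measurable_pi_lambda _ _ _ (signalAlgebra y u w) _ _ fun s => by
      rcases s with k | k
      · exact @ARXModel.measurable_output _ S _ (signalAlgebra y u w) 0 Fin.elim0 _ (hrep x) w
          measurable_signal_w (k + 1)
      · exact hrep x i k
  have hg : Measurable fun f : Fin T₂ ⊕ Fin T₂ → ℝ =>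
      (((fun k => f (Sum.inl k)), fun k => f (Sum.inr k)) : (Fin T₂ → ℝ) × (Fin T₂ → ℝ)) := by
    fun_prop
  refine h.measure_release_le hb
    (f := Sum.elim (fun k : Fin T₂ => Sum.inl (k : ℕ)) (fun k : Fin T₂ => Sum.inr (i, (k : ℕ))))
    ?_ hle (hmeas x) (hmeas x') (fun ω => ?_) hg hD
  · rintro (k | k) (k' | k') hk <;> simp [Fin.ext_iff] at hk ⊢
    · exact hk
    · exact hk
  rw [Fintype.sum_sum_type]
  simp only [hVdef, Sum.elim_inl, Sum.elim_inr, scale]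
  rw [← Finset.sum_div, ← Finset.sum_div]
  rw [Fin.sum_univ_eq_sum_range (fun k =>
      |S.output 0 Fin.elim0 (ARXModel.replaceInput i T₁ x fun j n => u j n ω) (fun n => w n ω)
        (k + 1) - S.output 0 Fin.elim0 (ARXModel.replaceInput i T₁ x' fun j n => u j n ω)
        (fun n => w n ω) (k + 1)|),
    Fin.sum_univ_eq_sum_range (fun k =>
      |ARXModel.replaceInput i T₁ x (fun j n => u j n ω) i k -
        ARXModel.replaceInput i T₁ x' (fun j n => u j n ω) i k|)]
  have h1 := S.sum_abs_output_replaceInput_sub_le hA hlam0 hlam1 hc₀ hT i x x' (fun i n => u i n ω)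
    (fun n => w n ω)
  have h2 := ARXModel.sum_abs_extend hT (fun k =>
      ARXModel.replaceInput i T₁ x (fun j n => u j n ω) i k -
        ARXModel.replaceInput i T₁ x' (fun j n => u j n ω) i k) x x'
    (fun k hk => by simp [ARXModel.replaceInput, hk])
    (fun k hk => by simp [ARXModel.replaceInput, not_lt.2 hk])
  rw [h2]
  have hK : 0 ≤ S.privacyConstInput c₀ lam i := by
    have : 0 < 1 - lam := by linarith
    rw [ARXModel.privacyConstInput]
    positivity
  refine le_trans ?_ hbi
  have hb0 := hb 0
  have hbi := hb i.succ
  calc _ ≤ S.privacyConstInput c₀ lam i * l1Dist x x' / b 0 + l1Dist x x' / b i.succ := by gcongr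
    _ = (S.privacyConstInput c₀ lam i / b 0 + 1 / b i.succ) * l1Dist x x' := by ring
    _ ≤ _ := by gcongr

end Mechanisms

/-! ### Laws of large numbers for the privacy noises -/

/-- On sets `A ∩ B`, a π-system generating `m₃ ⊔ m₂`, the two hypotheses give `P (C ∩ A ∩ B) = P (C
∩ B) P A = P C P B P A`. It is used with `m₁` a new noise, `m₂` the earlier ones and `m₃` the
signals. -/
theorem indep_sup_right {Ω : Type*} {m₁ m₂ m₃ mΩ : MeasurableSpace Ω} {P : Measure Ω}
    [IsProbabilityMeasure P] (h₁ : m₁ ≤ mΩ) (h₂ : m₂ ≤ mΩ) (h₃ : m₃ ≤ mΩ)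
    (h12 : Indep m₁ m₂ P) (h123 : Indep (m₁ ⊔ m₂) m₃ P) : Indep m₁ (m₃ ⊔ m₂) P := by
  set p : Set (Set Ω) := {s | ∃ A B, MeasurableSet[m₃] A ∧ MeasurableSet[m₂] B ∧ s = A ∩ B} with hp
  have hpi : IsPiSystem p := by
    rintro _ ⟨A, B, hA, hB, rfl⟩ _ ⟨A', B', hA', hB', rfl⟩ _
    exact ⟨A ∩ A', B ∩ B', hA.inter hA', hB.inter hB', Set.inter_inter_inter_comm _ _ _ _⟩
  have hgen : m₃ ⊔ m₂ = MeasurableSpace.generateFrom p := by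
    refine le_antisymm (sup_le (fun A hA => ?_) fun B hB => ?_)
      (MeasurableSpace.generateFrom_le ?_)
    · exact MeasurableSpace.measurableSet_generateFrom ⟨A, Set.univ, hA, MeasurableSet.univ, by simp⟩
    · exact MeasurableSpace.measurableSet_generateFrom ⟨Set.univ, B, MeasurableSet.univ, hB, by simp⟩
    · rintro _ ⟨A, B, hA, hB, rfl⟩
      exact MeasurableSet.inter ((le_sup_left : m₃ ≤ m₃ ⊔ m₂) _ hA)
        ((le_sup_right : m₂ ≤ m₃ ⊔ m₂) _ hB)
  refine IndepSets.indep h₁ (sup_le h₃ h₂) (@MeasurableSpace.isPiSystem_measurableSet _ m₁) hpi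
    (@MeasurableSpace.generateFrom_measurableSet _ m₁).symm hgen ?_
  rw [IndepSets_iff]
  rintro C _ hC ⟨A, B, hA, hB, rfl⟩
  rw [Indep_iff] at h12 h123
  have hC' : MeasurableSet[m₁ ⊔ m₂] C := (le_sup_left : m₁ ≤ m₁ ⊔ m₂) _ hC
  have hB' : MeasurableSet[m₁ ⊔ m₂] B := (le_sup_right : m₂ ≤ m₁ ⊔ m₂) _ hB
  have e1 : C ∩ (A ∩ B) = (C ∩ B) ∩ A := by
    rw [Set.inter_comm A B, Set.inter_assoc]
  rw [e1, Set.inter_comm A B, h123 _ _ (hC'.inter hB') hA, h123 _ _ hB' hA, h12 _ _ hC hB,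
    mul_assoc]

namespace PrivacyNoise

variable {Ω : Type*} [mΩ : MeasurableSpace Ω] {P : Measure Ω} [IsProbabilityMeasure P] {m : ℕ}
  {b : Fin (m + 1) → ℝ} {η : ℕ → Ω → ℝ} {ξ : Fin m → ℕ → Ω → ℝ}
  {y : ℕ → Ω → ℝ} {u : Fin m → ℕ → Ω → ℝ} {w : ℕ → Ω → ℝ}

/-- The noise added by participant `c`. -/
def part (η : ℕ → Ω → ℝ) (ξ : Fin m → ℕ → Ω → ℝ) (c : Fin (m + 1)) : ℕ → Ω → ℝ :=
  Fin.cases η ξ c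

/-- The participant to which a noise variable belongs. -/
def owner : ℕ ⊕ (Fin m × ℕ) → Fin (m + 1) := Sum.elim (fun _ => 0) (fun ik => ik.1.succ)

/-- The time of a noise variable. -/
def time : ℕ ⊕ (Fin m × ℕ) → ℕ := Sum.elim (fun k => k + 1) (fun ik => ik.2)

theorem scale_eq (s : ℕ ⊕ (Fin m × ℕ)) : scale b s = b (owner s) := by
  rcases s with k | ⟨i, k⟩ <;> rfl

omit mΩ in
theorem part_eq_zero_or (hη : ∀ ω, η 0 ω = 0) (c : Fin (m + 1)) (n : ℕ) :
    part η ξ c n = 0 ∨ ∃ s, owner s = c ∧ time s = n ∧ part η ξ c n = family η ξ s := by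
  refine Fin.cases ?_ (fun i => ?_) c
  · rcases n with _ | n
    · exact Or.inl (funext hη)
    · exact Or.inr ⟨Sum.inl n, rfl, rfl, rfl⟩
  · exact Or.inr ⟨Sum.inr (i, n), rfl, rfl, rfl⟩

/-- Noise variables of the other participants and those of participant `c` up to time `k - j`. -/
def pastIndex (c : Fin (m + 1)) (j k : ℕ) : Set (ℕ ⊕ (Fin m × ℕ)) :=
  {s | owner s ≠ c ∨ time s + j < k + 1}

/-- The signals, the noises of the other participants and the noise of `c` up to time `k - j`. -/
def past (h : PrivacyNoise P b η ξ y u w) (hle : signalAlgebra y u w ≤ mΩ) (c : Fin (m + 1))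
    (j : ℕ) : Filtration ℕ mΩ where
  seq k := signalAlgebra y u w ⊔
    ⨆ s ∈ pastIndex c j k, MeasurableSpace.comap (family η ξ s) inferInstance
  mono' k k' hk := sup_le_sup le_rfl <| biSup_mono fun s hs => by
    rcases hs with hs | hs
    · exact Or.inl hs
    · exact Or.inr (by omega)
  le' k := sup_le hle <| iSup₂_le fun s _ => (h.measurable_family s).comap_le

variable {h : PrivacyNoise P b η ξ y u w} {hle : signalAlgebra y u w ≤ mΩ}

omit [IsProbabilityMeasure P] in
theorem measurable_past_of_signal {c : Fin (m + 1)} {j k : ℕ} {f : Ω → ℝ}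
    (hf : Measurable[signalAlgebra y u w] f) : Measurable[h.past hle c j k] f :=
  hf.mono le_sup_left le_rfl

omit [IsProbabilityMeasure P] in
theorem measurable_past_family {c : Fin (m + 1)} {j k : ℕ} {s : ℕ ⊕ (Fin m × ℕ)}
    (hs : s ∈ pastIndex c j k) : Measurable[h.past hle c j k] (family η ξ s) :=
  (comap_measurable (family η ξ s)).mono
    ((le_iSup₂ (f := fun s (_ : s ∈ pastIndex c j k) =>
      MeasurableSpace.comap (family η ξ s) inferInstance) s hs).trans le_sup_right) le_rfl

omit [IsProbabilityMeasure P] in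
theorem measurable_past_part {c c' : Fin (m + 1)} {j k n : ℕ} (hn : c' ≠ c ∨ n + j < k + 1) :
    Measurable[h.past hle c j k] (part η ξ c' n) := by
  rcases part_eq_zero_or (ξ := ξ) h.eta_zero c' n with h0 | ⟨s, h1, h2, h3⟩
  · rw [h0]; exact measurable_const
  · rw [h3]
    refine measurable_past_family ?_
    rcases hn with hn | hn
    · exact Or.inl (h1 ▸ hn)
    · exact Or.inr (h2 ▸ hn)

theorem indep_family_past {c : Fin (m + 1)} {j k : ℕ} {s : ℕ ⊕ (Fin m × ℕ)}
    (hs : s ∉ pastIndex c j k) :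
    Indep (MeasurableSpace.comap (family η ξ s) inferInstance) (h.past hle c j k) P := by
  have hfam : ∀ s, MeasurableSpace.comap (family η ξ s) inferInstance ≤ mΩ := fun s =>
    (h.measurable_family s).comap_le
  have hN : ∀ s, MeasurableSpace.comap (family η ξ s) inferInstance ≤ noiseAlgebra η ξ := fun s =>
    (measurable_noise_family s).comap_le
  refine indep_sup_right (hfam s) (iSup₂_le fun s _ => hfam s) hle ?_ ?_
  · have := indep_iSup_of_disjoint hfam h.iIndep.iIndep (S := {s}) (T := pastIndex c j k)
      (Set.disjoint_singleton_left.2 hs)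
    simpa using this
  · exact indep_of_indep_of_le_left h.indep_noise_signal
      (sup_le (hN s) (iSup₂_le fun s _ => hN s))

omit [IsProbabilityMeasure P] in
theorem lintegral_sq_family (h : PrivacyNoise P b η ξ y u w) (hb : ∀ i, 0 < b i)
    (s : ℕ ⊕ (Fin m × ℕ)) :
    ∫⁻ ω, ENNReal.ofReal (family η ξ s ω ^ 2) ∂P = ENNReal.ofReal (2 * b (owner s) ^ 2) := by
  have h1 := lintegral_abs_pow_laplaceMeasure (hb (owner s)) 2
  rw [← scale_eq (b := b), ← h.law_family s, lintegral_map (by fun_prop) (h.measurable_family s)] at h1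
  simp only [sq_abs] at h1
  rw [h1, scale_eq]
  congr 1
  norm_num [Nat.factorial]
  ring

omit [IsProbabilityMeasure P] in
theorem memLp_family (h : PrivacyNoise P b η ξ y u w) (hb : ∀ i, 0 < b i)
    (s : ℕ ⊕ (Fin m × ℕ)) : MemLp (family η ξ s) 2 P := by
  rw [memLp_two_iff_integrable_sq (h.measurable_family s).aestronglyMeasurable]
  refine ⟨((h.measurable_family s).pow_const 2).aestronglyMeasurable, ?_⟩
  rw [hasFiniteIntegral_iff_ofReal (ae_of_all _ fun ω => sq_nonneg _), h.lintegral_sq_family hb]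
  exact ENNReal.ofReal_lt_top

omit [IsProbabilityMeasure P] in
theorem integral_sq_family (h : PrivacyNoise P b η ξ y u w) (hb : ∀ i, 0 < b i)
    (s : ℕ ⊕ (Fin m × ℕ)) : ∫ ω, family η ξ s ω ^ 2 ∂P = 2 * b (owner s) ^ 2 := by
  rw [integral_eq_lintegral_of_nonneg_ae (ae_of_all _ fun ω => sq_nonneg _)
    (h.memLp_family hb s).integrable_sq.aestronglyMeasurable, h.lintegral_sq_family hb,
    ENNReal.toReal_ofReal (by positivity)]

-- The Laplace density is even, so the reflection `x ↦ -x` shows that the mean equals its own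
-- negative.
omit [IsProbabilityMeasure P] in
theorem integral_family (h : PrivacyNoise P b η ξ y u w) (s : ℕ ⊕ (Fin m × ℕ)) :
    ∫ ω, family η ξ s ω ∂P = 0 := by
  have h1 : ∫ ω, family η ξ s ω ∂P = ∫ x, x ∂(laplaceMeasure (scale b s)) := by
    rw [← h.law_family s]
    exact (integral_map (h.measurable_family s).aemeasurable
      measurable_id.aestronglyMeasurable).symm
  rw [h1, laplaceMeasure, integral_withDensity_eq_integral_toReal_smul
    (measurable_laplaceDensity _) (ae_of_all _ fun _ => ENNReal.ofReal_lt_top)]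
  have h2 := integral_neg_eq_self (fun x : ℝ => (ENNReal.ofReal (1 / (2 * scale b s) *
    Real.exp (-|x| / scale b s))).toReal • x) volume
  simp only [abs_neg, smul_neg, integral_neg] at h2
  linarith

/-- Weighted law of large numbers for the noise of one participant. -/
theorem ae_tendsto_average_mul_lag (h : PrivacyNoise P b η ξ y u w) (hb : ∀ i, 0 < b i)
    (hle : signalAlgebra y u w ≤ mΩ) (c : Fin (m + 1)) (j : ℕ) {v : ℕ → Ω → ℝ}
    (hv : ∀ k, Measurable[h.past hle c j k] (v k))
    (hsum : ∀ᵐ ω ∂P, Summable fun k : ℕ => (v k ω / ((k : ℝ) + 1)) ^ 2) :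
    ∀ᵐ ω ∂P, Tendsto (fun n : ℕ => (n : ℝ)⁻¹ * ∑ k ∈ Finset.range n,
      v k ω * lag (fun n => part η ξ c n ω) (k + 1) j) atTop (𝓝 0) := by
  set X : ℕ → Ω → ℝ := fun k ω => lag (fun n => part η ξ c n ω) (k + 1) j with hX
  have hcases : ∀ k, X k = 0 ∨ ∃ s, owner s = c ∧ time s + j = k + 1 ∧ X k = family η ξ s := by
    intro k
    by_cases hj : j ≤ k + 1
    · have e : X k = part η ξ c (k + 1 - j) := by ext ω; simp [hX, lag, hj]
      rw [e]
      rcases part_eq_zero_or (ξ := ξ) h.eta_zero c (k + 1 - j) with h0 | ⟨s, h1, h2, h3⟩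
      · exact Or.inl h0
      · exact Or.inr ⟨s, h1, by omega, h3⟩
    · exact Or.inl (by ext ω; simp [hX, lag, hj])
  -- The noise used at step `k` has time `k + 1 - j`: the first one of participant `c` outside the
  -- past at `k`, and inside the past at `k + 1`.
  have hnot : ∀ {k s}, owner s = c → time s + j = k + 1 → s ∉ pastIndex c j k := by
    rintro k s h1 h2 (h3 | h3)
    · exact h3 h1
    · omega
  have hXm : ∀ k, Measurable[h.past hle c j (k + 1)] (X k) := by
    intro k
    rcases hcases k with h0 | ⟨s, h1, h2, h3⟩
    · rw [h0]; exact measurable_const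
    · rw [h3]; exact measurable_past_family (Or.inr (by omega))
  have hXint : ∀ k, Integrable (X k) P := by
    intro k
    rcases hcases k with h0 | ⟨s, h1, h2, h3⟩
    · rw [h0]; exact integrable_zero _ _ _
    · rw [h3]; exact (h.memLp_family hb s).integrable (by norm_num)
  have hcond : ∀ k, P[X k|h.past hle c j k] =ᵐ[P] 0 := by
    intro k
    rcases hcases k with h0 | ⟨s, h1, h2, h3⟩
    · rw [h0, condExp_zero]
    · rw [h3]
      refine (condExp_indep_eq (h.measurable_family s).comap_le ((h.past hle c j).le k)
        (comap_measurable (family η ξ s)).stronglyMeasurable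
        (indep_family_past (hnot h1 h2))).trans ?_
      rw [h.integral_family]
      rfl
  have hC : ∀ k s, MeasurableSet[h.past hle c j k] s →
      ∫⁻ ω in s, ENNReal.ofReal (X k ω ^ 2) ∂P ≤
        ∫⁻ ω in s, ENNReal.ofReal (2 * b c ^ 2) ∂P := by
    intro k A hA
    rcases hcases k with h0 | ⟨s, h1, h2, h3⟩
    · simp [h0]
    · have hA' := (h.past hle c j).le k _ hA
      rw [h3, ← lintegral_indicator hA']
      have e1 : ∀ ω, A.indicator (fun ω => ENNReal.ofReal (family η ξ s ω ^ 2)) ω =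
          ENNReal.ofReal (family η ξ s ω ^ 2) * A.indicator 1 ω := by
        intro ω
        by_cases hω : ω ∈ A <;> simp [hω]
      simp_rw [e1]
      have e2 := lintegral_mul_eq_lintegral_mul_lintegral_of_independent_measurableSpace
        (f := fun ω => ENNReal.ofReal (family η ξ s ω ^ 2)) (g := A.indicator 1)
        (h.measurable_family s).comap_le ((h.past hle c j).le k)
        (indep_family_past (hnot h1 h2))
        (ENNReal.measurable_ofReal.comp ((comap_measurable (family η ξ s)).pow_const 2))
        ((@measurable_const _ _ _ (h.past hle c j k) (1 : ENNReal)).indicator hA)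
      rw [e2, h.lintegral_sq_family hb, lintegral_indicator_one hA', setLIntegral_const, h1]
  have hmain := ae_tendsto_sum_martingale_transform (h.past hle c j)
    (fun k ω => v k ω / ((k : ℝ) + 1)) X (fun _ _ => ENNReal.ofReal (2 * b c ^ 2))
    (fun k => (hv k).div_const _) hXm hXint hcond (fun _ => measurable_const) hC (by
      filter_upwards [hsum] with ω hω
      rw [ENNReal.tsum_mul_right, ← ENNReal.ofReal_tsum_of_nonneg (fun _ => sq_nonneg _) hω]
      exact ENNReal.mul_lt_top ENNReal.ofReal_lt_top ENNReal.ofReal_lt_top)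
  filter_upwards [hmain] with ω ⟨l, hl⟩
  refine tendsto_average_of_tendsto_sum_div (c := l) ?_
  convert hl using 3 with n k
  simp only [hX]
  ring

end PrivacyNoise

/-! ### Averages along shifted sequences -/

theorem summable_sq_div_of_isBigO {v : ℕ → ℝ}
    (h : (fun n : ℕ => ∑ k ∈ Finset.range n, v k ^ 2) =O[atTop] fun n : ℕ => (n : ℝ)) :
    Summable fun k : ℕ => (v k / ((k : ℝ) + 1)) ^ 2 := by
  obtain ⟨B, hB, hbound⟩ := Asymptotics.bound_of_isBigO_nat_atTop h
  refine summable_sq_div_of_sum_le (B := B) fun n => ?_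
  rcases Nat.eq_zero_or_pos n with rfl | hn
  · simp
  · have := hbound (x := n) (by positivity)
    rw [Real.norm_natCast] at this
    exact (le_abs_self _).trans this

theorem isBigO_of_tendsto_average {x : ℕ → ℝ} {L : ℝ}
    (h : Tendsto (fun n : ℕ => (n : ℝ)⁻¹ * ∑ k ∈ Finset.range n, x k) atTop (𝓝 L)) :
    (fun n : ℕ => ∑ k ∈ Finset.range n, x k) =O[atTop] fun n : ℕ => (n : ℝ) := by
  have h1 := (h.isBigO_one ℝ).mul (Asymptotics.isBigO_refl (fun n : ℕ => (n : ℝ)) atTop)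
  simp only [one_mul] at h1
  refine h1.congr' ?_ EventuallyEq.rfl
  filter_upwards [eventually_gt_atTop 0] with n hn
  have : (n : ℝ) ≠ 0 := by positivity
  field_simp

theorem tendsto_average_of_shift {x : ℕ → ℝ} {L : ℝ}
    (h : Tendsto (fun n : ℕ => (n : ℝ)⁻¹ * ∑ k ∈ Finset.range n, x (k + 1)) atTop (𝓝 L)) :
    Tendsto (fun n : ℕ => (n : ℝ)⁻¹ * ∑ k ∈ Finset.range n, x k) atTop (𝓝 L) := by
  rw [← tendsto_add_atTop_iff_nat 1]
  have h1 : Tendsto (fun n : ℕ => (n : ℝ) / ((n : ℝ) + 1)) atTop (𝓝 1) :=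
    tendsto_natCast_div_add_atTop 1
  have h2 : Tendsto (fun n : ℕ => 1 / ((n : ℝ) + 1) * x 0) atTop (𝓝 (0 * x 0)) :=
    tendsto_one_div_add_atTop_nhds_zero_nat.mul_const _
  have h3 := (h1.mul h).add h2
  rw [one_mul, zero_mul, add_zero] at h3
  refine h3.congr' ?_
  filter_upwards [eventually_gt_atTop 0] with n hn
  have h4 : (n : ℝ) ≠ 0 := by positivity
  have h5 : (n : ℝ) + 1 ≠ 0 := by positivity
  rw [Finset.sum_range_succ']
  push_cast
  field_simp

theorem lag_succ_succ (x : ℕ → ℝ) (k j : ℕ) : lag x (k + 1) (j + 1) = lag x k j := by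
  simp [lag]

theorem tendsto_average_lag {x : ℕ → ℝ} {L : ℝ}
    (h : Tendsto (fun n : ℕ => (n : ℝ)⁻¹ * ∑ k ∈ Finset.range n, x k) atTop (𝓝 L)) (j : ℕ) :
    Tendsto (fun n : ℕ => (n : ℝ)⁻¹ * ∑ k ∈ Finset.range n, lag x k j) atTop (𝓝 L) := by
  induction j with
  | zero => simpa [lag] using h
  | succ j ih =>
    refine tendsto_average_of_shift ?_
    simpa only [lag_succ_succ] using ih

theorem lag_sq (x : ℕ → ℝ) (k j : ℕ) : lag x k j ^ 2 = lag (fun n => x n ^ 2) k j := by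
  unfold lag
  split_ifs <;> simp

namespace PrivacyNoise

variable {Ω : Type*} [mΩ : MeasurableSpace Ω] {P : Measure Ω} [IsProbabilityMeasure P] {m : ℕ}
  {b : Fin (m + 1) → ℝ} {η : ℕ → Ω → ℝ} {ξ : Fin m → ℕ → Ω → ℝ}
  {y : ℕ → Ω → ℝ} {u : Fin m → ℕ → Ω → ℝ} {w : ℕ → Ω → ℝ}

omit [IsProbabilityMeasure P] in
theorem ae_tendsto_average_sq_lag (h : PrivacyNoise P b η ξ y u w) (hb : ∀ i, 0 < b i)
    (c : Fin (m + 1)) (j : ℕ) :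
    ∀ᵐ ω ∂P, Tendsto (fun n : ℕ => (n : ℝ)⁻¹ * ∑ k ∈ Finset.range n,
      lag (fun n => part η ξ c n ω) k j ^ 2) atTop (𝓝 (2 * b c ^ 2)) := by
  -- Times start at `1`, since the output noise at time `0` is zero rather than Laplace; the shift
  -- lemma restores the missing term.
  obtain ⟨s, hinj, hown, hs⟩ : ∃ s : ℕ → ℕ ⊕ (Fin m × ℕ), Function.Injective s ∧
      (∀ n, owner (s n) = c) ∧ ∀ n, part η ξ c (n + 1) = family η ξ (s n) := by
    refine Fin.cases ?_ (fun i => ?_) c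
    · exact ⟨Sum.inl, Sum.inl_injective, fun _ => rfl, fun _ => rfl⟩
    · exact ⟨fun n => Sum.inr (i, n + 1), fun n n' hn => by simpa using hn, fun _ => rfl,
        fun _ => rfl⟩
  have hsl := strong_law_ae_real (μ := P) (fun n ω => family η ξ (s n) ω ^ 2)
    (h.memLp_family hb (s 0)).integrable_sq
    (fun n n' hn => by
      have := h.iIndep.indepFun (hinj.ne hn)
      exact this.comp (φ := fun x : ℝ => x ^ 2) (ψ := fun x : ℝ => x ^ 2)
        (by fun_prop) (by fun_prop))
    (fun n => by
      have hid : IdentDistrib (family η ξ (s n)) (family η ξ (s 0)) P P :=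
        ⟨(h.measurable_family _).aemeasurable, (h.measurable_family _).aemeasurable, by
          rw [h.law_family, h.law_family, scale_eq, scale_eq, hown, hown]⟩
      exact hid.comp (u := fun x : ℝ => x ^ 2) (by fun_prop))
  filter_upwards [hsl] with ω hω
  simp only [lag_sq]
  refine tendsto_average_lag (tendsto_average_of_shift ?_) j
  rw [h.integral_sq_family hb, hown] at hω
  refine hω.congr fun n => ?_
  rw [div_eq_inv_mul]
  simp [hs]

omit [IsProbabilityMeasure P] in
theorem ae_summable_lag (h : PrivacyNoise P b η ξ y u w) (hb : ∀ i, 0 < b i)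
    (c : Fin (m + 1)) (j : ℕ) :
    ∀ᵐ ω ∂P, Summable fun k : ℕ =>
      (lag (fun n => part η ξ c n ω) k j / ((k : ℝ) + 1)) ^ 2 := by
  filter_upwards [h.ae_tendsto_average_sq_lag hb c j] with ω hω
  exact summable_sq_div_of_isBigO (isBigO_of_tendsto_average hω)

omit [IsProbabilityMeasure P] in
theorem measurable_past_lag {h : PrivacyNoise P b η ξ y u w} {hle : signalAlgebra y u w ≤ mΩ}
    {c c' : Fin (m + 1)} {j j' k : ℕ} (hc : c' ≠ c ∨ j ≤ j') :
    Measurable[h.past hle c j k] fun ω => lag (fun n => part η ξ c' n ω) k j' := by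
  unfold lag
  split_ifs with hk
  · exact measurable_past_part (hc.imp_right fun _ => by omega)
  · exact measurable_const

/-- Distinct lagged noises are asymptotically uncorrelated. -/
theorem ae_tendsto_average_lag_mul_lag (h : PrivacyNoise P b η ξ y u w) (hb : ∀ i, 0 < b i)
    (hle : signalAlgebra y u w ≤ mΩ) {c c' : Fin (m + 1)} {j j' : ℕ} (hne : (c, j) ≠ (c', j')) :
    ∀ᵐ ω ∂P, Tendsto (fun n : ℕ => (n : ℝ)⁻¹ * ∑ k ∈ Finset.range n,
      lag (fun n => part η ξ c n ω) k j * lag (fun n => part η ξ c' n ω) k j') atTop (𝓝 0) := by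
  -- For a single participant the older noise must be the weight, so that it is predictable when the
  -- newer one arrives; symmetry covers the other order.
  have key : ∀ (c c' : Fin (m + 1)) (j j' : ℕ), (c ≠ c' ∨ j' < j) →
      ∀ᵐ ω ∂P, Tendsto (fun n : ℕ => (n : ℝ)⁻¹ * ∑ k ∈ Finset.range n,
        lag (fun n => part η ξ c n ω) k j * lag (fun n => part η ξ c' n ω) k j') atTop (𝓝 0) := by
    intro c c' j j' hc
    have := h.ae_tendsto_average_mul_lag hb hle c' (j' + 1)
      (v := fun k ω => lag (fun n => part η ξ c n ω) k j)
      (fun k => measurable_past_lag (hc.imp_right fun h => h)) (h.ae_summable_lag hb c j)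
    simpa only [lag_succ_succ] using this
  by_cases hc : c = c'
  · rcases lt_trichotomy j j' with hj | hj | hj
    · simpa only [mul_comm] using key c' c j' j (Or.inr hj)
    · exact absurd (Prod.ext hc hj) hne
    · exact key c c' j j' (Or.inr hj)
  · exact key c c' j j' (Or.inl hc)

end PrivacyNoise

/-! ### The system noise -/

namespace SystemNoise

variable {Ω : Type*} [mΩ : MeasurableSpace Ω] {P : Measure Ω} [IsProbabilityMeasure P]
  {ℱ : Filtration ℕ mΩ} {β : ℝ} {w : ℕ → Ω → ℝ}

omit [IsProbabilityMeasure P] in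
theorem measurable (hw : SystemNoise P ℱ β w) (k : ℕ) : Measurable (w (k + 1)) :=
  (hw.adapted k).mono (ℱ.le _) le_rfl

/-- Predictable bound of the conditional second moment. -/
theorem setLIntegral_sq_le (hβ : 2 ≤ β) (k : ℕ) {s : Set Ω} (hs : MeasurableSet[ℱ k] s) :
    ∫⁻ ω in s, ENNReal.ofReal (w (k + 1) ω ^ 2) ∂P ≤
      ∫⁻ ω in s, (1 + condLExp (ℱ k) P (fun ω' => ENNReal.ofReal (|w (k + 1) ω'| ^ β)) ω) ∂P := by
  rw [lintegral_add_left measurable_const, setLIntegral_condLExp (ℱ.le k) _ _ hs,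
    ← lintegral_add_left measurable_const]
  refine lintegral_mono fun ω => ?_
  -- Pointwise `w² ≤ 1 + |w|^β` because `β ≥ 2`; the `1` covers the values with `|w| ≤ 1`.
  rw [← ENNReal.ofReal_one, ← ENNReal.ofReal_add zero_le_one (by positivity)]
  refine ENNReal.ofReal_le_ofReal ?_
  rw [← sq_abs]
  have h0 := abs_nonneg (w (k + 1) ω)
  rcases le_total |w (k + 1) ω| 1 with h | h
  · have := Real.rpow_nonneg h0 β
    nlinarith
  · have := Real.rpow_le_rpow_of_exponent_le h hβ
    rw [Real.rpow_two] at this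
    linarith

omit [IsProbabilityMeasure P] in
theorem measurable_bound (k : ℕ) : Measurable[ℱ k] fun ω =>
    (1 + condLExp (ℱ k) P (fun ω' => ENNReal.ofReal (|w (k + 1) ω'| ^ β)) ω : ENNReal) :=
  measurable_const.add (measurable_condLExp _ _ _)

omit [IsProbabilityMeasure P] in
theorem ae_tsum_mul_bound_lt_top (hw : SystemNoise P ℱ β w) {a : ℕ → Ω → ℝ}
    (ha : ∀ᵐ ω ∂P, Summable fun k => a k ω ^ 2) :
    ∀ᵐ ω ∂P, ∑' k, ENNReal.ofReal (a k ω ^ 2) *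
      (1 + condLExp (ℱ k) P (fun ω' => ENNReal.ofReal (|w (k + 1) ω'| ^ β)) ω) < ⊤ := by
  filter_upwards [ha, hw.moment] with ω h1 h2
  refine lt_of_le_of_lt (ENNReal.tsum_le_tsum fun k => mul_le_mul_right (add_le_add_right
    (le_iSup (fun k => condLExp (ℱ k) P (fun ω' => ENNReal.ofReal (|w (k + 1) ω'| ^ β)) ω) k) 1) _)
    ?_
  rw [ENNReal.tsum_mul_right, ← ENNReal.ofReal_tsum_of_nonneg (fun _ => sq_nonneg _) h1]
  exact ENNReal.mul_lt_top ENNReal.ofReal_lt_top (ENNReal.add_lt_top.2 ⟨ENNReal.one_lt_top, h2⟩)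

/-- The series of `w² / (k+1)²` is compared with its predictable bounds, which sum because the
conditional moments are almost surely bounded. It allows `w` to act as the weight of a privacy
noise. -/
theorem ae_summable (hw : SystemNoise P ℱ β w) (hβ : 2 ≤ β) :
    ∀ᵐ ω ∂P, Summable fun k : ℕ => (w (k + 1) ω / ((k : ℝ) + 1)) ^ 2 := by
  have hs : Summable fun k : ℕ => (1 / ((k : ℝ) + 1)) ^ 2 :=
    summable_sq_div_of_sum_le (v := fun _ => 1) (B := 1) fun n => by simp
  have := ae_tsum_lt_top_of_predictable (P := P) ℱ
    (fun k ω => ENNReal.ofReal ((1 / ((k : ℝ) + 1)) ^ 2) * ENNReal.ofReal (w (k + 1) ω ^ 2))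
    (fun k ω => ENNReal.ofReal ((1 / ((k : ℝ) + 1)) ^ 2) *
      (1 + condLExp (ℱ k) P (fun ω' => ENNReal.ofReal (|w (k + 1) ω'| ^ β)) ω))
    (fun k => (ENNReal.measurable_ofReal.comp ((hw.measurable k).pow_const 2)).const_mul _)
    (fun k => (measurable_bound k).const_mul _)
    (fun k s hs => by
      rw [lintegral_const_mul' _ _ ENNReal.ofReal_ne_top,
        lintegral_const_mul' _ _ ENNReal.ofReal_ne_top]
      refine mul_le_mul_right ?_ _
      exact setLIntegral_sq_le (P := P) (w := w) hβ k hs)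
    (hw.ae_tsum_mul_bound_lt_top (a := fun k _ => 1 / ((k : ℝ) + 1)) (ae_of_all _ fun _ => hs))
  filter_upwards [this] with ω hω
  have h1 : ∀ k : ℕ, ENNReal.ofReal ((1 / ((k : ℝ) + 1)) ^ 2) * ENNReal.ofReal (w (k + 1) ω ^ 2) =
      ENNReal.ofReal ((w (k + 1) ω / ((k : ℝ) + 1)) ^ 2) := fun k => by
    rw [← ENNReal.ofReal_mul (sq_nonneg _)]
    congr 1
    ring
  simp_rw [h1] at hω
  have h2 := ENNReal.summable_toReal hω.ne
  refine h2.congr fun k => ?_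
  rw [ENNReal.toReal_ofReal (sq_nonneg _)]

/-- Weighted law of large numbers for the system noise. -/
theorem ae_tendsto_average_mul (hw : SystemNoise P ℱ β w) (hβ : 2 ≤ β) {v : ℕ → Ω → ℝ}
    (hv : ∀ k, Measurable[ℱ k] (v k))
    (hsum : ∀ᵐ ω ∂P, Summable fun k : ℕ => (v k ω / ((k : ℝ) + 1)) ^ 2) :
    ∀ᵐ ω ∂P, Tendsto (fun n : ℕ => (n : ℝ)⁻¹ * ∑ k ∈ Finset.range n, v k ω * w (k + 1) ω)
      atTop (𝓝 0) := by
  have hmain := ae_tendsto_sum_martingale_transform (P := P) ℱ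
    (fun k ω => v k ω / ((k : ℝ) + 1)) (fun k => w (k + 1)) _
    (fun k => (hv k).div_const _) hw.adapted hw.integrable hw.condExp_eq_zero measurable_bound
    (fun k s hs => setLIntegral_sq_le (P := P) (w := w) hβ k hs) (hw.ae_tsum_mul_bound_lt_top hsum)
  filter_upwards [hmain] with ω ⟨l, hl⟩
  refine tendsto_average_of_tendsto_sum_div (c := l) ?_
  convert hl using 3 with n k
  ring

end SystemNoise

/-! ### The identification error -/

namespace ARXModel

variable {m : ℕ} (S : ARXModel m)

/-- The participant to which a coordinate of the regression vector belongs. -/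
def idxPart : S.Idx → Fin (m + 1) := Sum.elim (fun _ => 0) (fun il => il.1.succ)

/-- The lag of a coordinate of the regression vector. -/
def idxLag : S.Idx → ℕ := Sum.elim (fun j => j) (fun il => il.2)

/-- Distinct coordinates of the regressor carry noises differing in participant or lag, so the
limiting noise covariance is diagonal. -/
theorem idx_injective : Function.Injective fun i => (S.idxPart i, S.idxLag i) := by
  rintro (j | ⟨i, l⟩) (j' | ⟨i', l'⟩) h
  · simp only [idxPart, idxLag, Sum.elim_inl, Prod.mk.injEq, true_and] at h
    rw [Fin.ext h]
  · simp only [idxPart, Sum.elim_inl, Sum.elim_inr, Prod.mk.injEq] at h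
    exact absurd h.1.symm (Fin.succ_ne_zero _)
  · simp only [idxPart, Sum.elim_inl, Sum.elim_inr, Prod.mk.injEq] at h
    exact absurd h.1 (Fin.succ_ne_zero _)
  · simp only [idxPart, idxLag, Sum.elim_inr, Prod.mk.injEq] at h
    obtain rfl := Fin.succ_injective _ h.1
    rw [Fin.ext h.2]

theorem regressor_noise_apply {Ω : Type*} (η : ℕ → Ω → ℝ) (ξ : Fin m → ℕ → Ω → ℝ) (k : ℕ) (ω : Ω)
    (i : S.Idx) : S.regressor η ξ k ω i =
      lag (fun n => PrivacyNoise.part η ξ (S.idxPart i) n ω) k (S.idxLag i) := by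
  rcases i with j | il <;> rfl

theorem regressor_add {Ω : Type*} (y η : ℕ → Ω → ℝ) (u ξ : Fin m → ℕ → Ω → ℝ) (k : ℕ) (ω : Ω) :
    S.regressor (y + η) (u + ξ) k ω = S.regressor y u k ω + S.regressor η ξ k ω := by
  ext i
  rcases i with j | il
  all_goals
    simp only [regressor, PiLp.add_apply, Sum.elim_inl, Sum.elim_inr, lag]
    split_ifs <;> simp

theorem drift_eq_dotProduct {Ω : Type*} (y : ℕ → Ω → ℝ) (u : Fin m → ℕ → Ω → ℝ) (k : ℕ) (ω : Ω) :
    S.drift (fun n => y n ω) (fun i n => u i n ω) k =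
      dotProduct (S.regressor y u k ω).ofLp S.theta.ofLp := by
  simp only [drift, dotProduct, Fintype.sum_sum_type, regressor, theta, Sum.elim_inl, Sum.elim_inr,
    Fintype.sum_sigma, mul_comm]

theorem sum_idx (f : Fin (m + 1) → ℝ) :
    ∑ i : S.Idx, f (S.idxPart i) = (S.p : ℝ) * f 0 + ∑ i : Fin m, (S.q i : ℝ) * f i.succ := by
  simp [Fintype.sum_sum_type, Fintype.sum_sigma, idxPart]

/-- Each `b²` is at most the sum over all coordinates, and `2 ≤ 4`; the stated bound is thus weaker
than the one obtained for the error. -/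
theorem sqrt_div_sqrt_le (b : Fin (m + 1) → ℝ) {Γ : ℝ} (hΓ : 0 < Γ) :
    √(2 * ∑ i, b (S.idxPart i) ^ 2 * S.theta i ^ 2) / √Γ ≤
      2 * ‖S.theta‖ * √(((S.p : ℝ) * b 0 ^ 2 + ∑ i : Fin m, (S.q i : ℝ) * b i.succ ^ 2) / Γ) := by
  rw [← S.sum_idx (fun c => b c ^ 2), Real.sqrt_div' _ hΓ.le, ← mul_div_assoc]
  gcongr
  refine Real.sqrt_le_iff.2 ⟨by positivity, ?_⟩
  rw [mul_pow, mul_pow, Real.sq_sqrt (Finset.sum_nonneg fun _ _ => sq_nonneg _)]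
  have h1 : ∑ i, b (S.idxPart i) ^ 2 * S.theta i ^ 2 ≤
      ∑ i : S.Idx, (∑ j : S.Idx, b (S.idxPart j) ^ 2) * S.theta i ^ 2 := by
    refine Finset.sum_le_sum fun i _ => mul_le_mul_of_nonneg_right ?_ (sq_nonneg _)
    exact Finset.single_le_sum (f := fun j : S.Idx => b (S.idxPart j) ^ 2)
      (fun _ _ => sq_nonneg _) (Finset.mem_univ i)
  rw [← Finset.mul_sum, ← EuclideanSpace.real_norm_sq_eq] at h1
  have h2 : 0 ≤ (∑ j : S.Idx, b (S.idxPart j) ^ 2) * ‖S.theta‖ ^ 2 :=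
    mul_nonneg (Finset.sum_nonneg fun _ _ => sq_nonneg _) (sq_nonneg _)
  linarith

end ARXModel

theorem measurable_regressor_apply {Ω : Type*} [MeasurableSpace Ω] {m : ℕ} (S : ARXModel m)
    {y : ℕ → Ω → ℝ} {u : Fin m → ℕ → Ω → ℝ} (hy : ∀ k, Measurable (y k))
    (hu : ∀ i k, Measurable (u i k)) (k : ℕ) (i : S.Idx) :
    Measurable fun ω => S.regressor y u k ω i := by
  rcases i with j | il
  · exact measurable_lag (fun n _ => hy n) j
  · exact measurable_lag (fun n _ => hu il.1 n) il.2

theorem summable_regressor_apply {ι : Type*} [Fintype ι] {φ : ℕ → EuclideanSpace ℝ ι}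
    (h : (fun k : ℕ => ∑ t ∈ Finset.Icc 1 k, ‖φ t‖ ^ 2) =O[atTop] fun k : ℕ => (k : ℝ)) (i : ι) :
    Summable fun k : ℕ => (φ k i / ((k : ℝ) + 1)) ^ 2 := by
  refine summable_sq_div_of_isBigO ?_
  -- The growth hypothesis starts at `t = 1`; the term at `0` is a constant and hence also `O(k)`.
  have h1 : (fun _ : ℕ => ‖φ 0‖ ^ 2) =O[atTop] fun k : ℕ => (k : ℝ) :=
    (Asymptotics.isLittleO_const_left.2 (Or.inr
      (tendsto_norm_atTop_atTop.comp tendsto_natCast_atTop_atTop))).isBigO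
  refine (Asymptotics.IsBigO.of_bound 1 (Eventually.of_forall fun n => ?_)).trans (h1.add h)
  rw [one_mul, Real.norm_of_nonneg (Finset.sum_nonneg fun _ _ => sq_nonneg _)]
  refine le_trans ?_ (le_abs_self _)
  have h2 : ∀ k, φ k i ^ 2 ≤ ‖φ k‖ ^ 2 := fun k =>
    sq_le_sq.2 (by simpa using PiLp.norm_apply_le (φ k) i)
  calc ∑ k ∈ Finset.range n, φ k i ^ 2 ≤ ∑ k ∈ Finset.range n, ‖φ k‖ ^ 2 :=
        Finset.sum_le_sum fun k _ => h2 k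
    _ ≤ ∑ k ∈ Finset.range (n + 1), ‖φ k‖ ^ 2 :=
        Finset.sum_le_sum_of_subset_of_nonneg (Finset.range_mono n.le_succ)
          fun _ _ _ => sq_nonneg _
    _ = ‖φ 0‖ ^ 2 + ∑ t ∈ Finset.Icc 1 n, ‖φ t‖ ^ 2 := by
        rw [Finset.sum_range_eq_add_Ico _ (Nat.succ_pos n)]
        rfl

end

theorem corollary3 {Ω : Type*} [mΩ : MeasurableSpace Ω] (P : Measure Ω) [IsProbabilityMeasure P]
    {m : ℕ} (S : ARXModel m)
    -- inputs, outputs, system noise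
    (u : Fin m → ℕ → Ω → ℝ) (hu : ∀ i k, Measurable (u i k))
    (w : ℕ → Ω → ℝ) (y : ℕ → Ω → ℝ)
    (hy : ∀ ω, S.IsOutput (fun k => y k ω) (fun i k => u i k ω) (fun k => w k ω))
    -- privacy noises with scales `b 0` (outputs) and `b i.succ` (inputs of participant `i`)
    (b : Fin (m + 1) → ℝ) (hb : ∀ i, 0 < b i)
    (η : ℕ → Ω → ℝ) (ξ : Fin m → ℕ → Ω → ℝ)
    -- the algorithm's initial data
    (α : ℝ) (hα : 0 < α) (θ₀ : EuclideanSpace ℝ S.Idx)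
    -- stability and independence of the noises
    (hstable : S.IsStable)
    (hnoise : PrivacyNoise P b η ξ y u w)
    -- martingale difference system noise, adapted regressors
    (ℱ : Filtration ℕ mΩ) (β : ℝ) (hβ : 2 ≤ β) (hw : SystemNoise P ℱ β w)
    (hadapted : ∀ k, Measurable[ℱ k] (S.regressor y u k))
    -- the noise scales are matched to the privacy indices
    (ε δ : ℝ) (hε : 0 < ε) (hδ : 0 < δ)
    (c₀ lam : ℝ) (hc₀ : 0 < c₀) (hlam0 : 0 < lam) (hlam1 : lam < 1)
    (hA : S.CompanionBound c₀ lam)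
    (hb0 : S.privacyConstOutput c₀ lam / b 0 * δ ≤ ε)
    (hbi : ∀ i : Fin m, (S.privacyConstInput c₀ lam i / b 0 + 1 / b i.succ) * δ ≤ ε)
    -- excitation of the noisy regressors
    (κ : ℝ) (hκ : 1 < κ)
    (hexc : ∀ᵐ ω ∂P, Tendsto (fun k : ℕ =>
      excitationGauge β κ (regressorEnergy (fun t => S.regressor (y + η) (u + ξ) t ω) k) /
        lamMin ((rlsCov α (fun t => S.regressor (y + η) (u + ξ) t ω) (k + 1))⁻¹)) atTop (𝓝 0))
    -- growth and excitation of the noise-free regressors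
    (hgrowth : ∀ᵐ ω ∂P, (fun k : ℕ => ∑ t ∈ Finset.Icc 1 k, ‖S.regressor y u t ω‖ ^ 2)
      =O[atTop] fun k : ℕ => (k : ℝ))
    (γ₃ : ℝ) (hγ₃ : 0 < γ₃)
    (hliminf : ∀ᵐ ω ∂P, (γ₃ : EReal) < liminf (fun k : ℕ =>
      ((lamMin (infoMatrix α (fun t => S.regressor y u t ω) k) / (k : ℝ) : ℝ) : EReal)) atTop) :
    ((∀ T₁ T₂ : ℕ, 1 ≤ T₁ → T₁ ≤ T₂ →
        IsDifferentiallyPrivate P l1Dist (S.outputMechanism u w η T₁ T₂) ε δ) ∧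
      (∀ (i : Fin m) (T₁ T₂ : ℕ), 1 ≤ T₁ → T₁ ≤ T₂ →
        IsDifferentiallyPrivate P l1Dist (S.inputMechanism u w η ξ i T₁ T₂) ε δ)) ∧
    ∀ᵐ ω ∂P,
      limsup (fun k : ℕ => ((‖S.theta - rlsEstimate α θ₀
          (fun t => S.regressor (y + η) (u + ξ) t ω) (fun t => (y + η) t ω) k‖ : ℝ) : EReal))
        atTop ≤
      ((2 * ‖S.theta‖ * √(((S.p : ℝ) * b 0 ^ 2 + ∑ i : Fin m, (S.q i : ℝ) * b i.succ ^ 2) /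
        (γ₃ + 2 * Finset.univ.inf' Finset.univ_nonempty fun i => b i ^ 2)) : ℝ) : EReal) := by
  classical
  have hwm : ∀ k, Measurable (w (k + 1)) := hw.measurable
  have hym : ∀ k, Measurable (y k) := ARXModel.IsOutput.measurable hy hu hwm
  have hle : PrivacyNoise.signalAlgebra y u w ≤ mΩ := PrivacyNoise.signalAlgebra_le hym hu hwm
  refine ⟨⟨fun T₁ T₂ _ hT => isDifferentiallyPrivate_outputMechanism hnoise hb hle hc₀ hlam0 hlam1
    hA hb0 hT, fun i T₁ T₂ _ hT => isDifferentiallyPrivate_inputMechanism hnoise hb hle hc₀ hlam0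
    hlam1 hA (hbi i) hT⟩, ?_⟩
  have hφm : ∀ k i, Measurable[PrivacyNoise.signalAlgebra y u w]
      fun ω => S.regressor y u k ω i := fun k i =>
    @measurable_regressor_apply _ (PrivacyNoise.signalAlgebra y u w) _ S y u
      PrivacyNoise.measurable_signal_y PrivacyNoise.measurable_signal_u k i
  have hφF : ∀ k i, Measurable[ℱ k] fun ω => S.regressor y u k ω i := fun k i =>
    (EuclideanSpace.proj (𝕜 := ℝ) i).continuous.measurable.comp (hadapted k)
  have hφs : ∀ i, ∀ᵐ ω ∂P, Summable fun k : ℕ => (S.regressor y u k ω i / ((k : ℝ) + 1)) ^ 2 :=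
    fun i => by
      filter_upwards [hgrowth] with ω hω
      exact summable_regressor_apply hω i
  -- The weighted law is stated for lags taken at `k + 1`, so the lag of the coordinate is raised by
  -- one.
  have hφζ : ∀ᵐ ω ∂P, ∀ i j, Tendsto (fun n : ℕ => (n : ℝ)⁻¹ * ∑ k ∈ Finset.range n,
      S.regressor y u k ω i * S.regressor η ξ k ω j) atTop (𝓝 0) := by
    refine ae_all_iff.2 fun i => ae_all_iff.2 fun j => ?_
    have := hnoise.ae_tendsto_average_mul_lag hb hle (S.idxPart j) (S.idxLag j + 1)
      (fun k => PrivacyNoise.measurable_past_of_signal (hφm k i)) (hφs i)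
    simpa only [lag_succ_succ, S.regressor_noise_apply] using this
  have hζζ : ∀ᵐ ω ∂P, ∀ i j, Tendsto (fun n : ℕ => (n : ℝ)⁻¹ * ∑ k ∈ Finset.range n,
      S.regressor η ξ k ω i * S.regressor η ξ k ω j) atTop
      (𝓝 (if i = j then 2 * b (S.idxPart i) ^ 2 else 0)) := by
    refine ae_all_iff.2 fun i => ae_all_iff.2 fun j => ?_
    split_ifs with hij
    · subst hij
      simpa only [S.regressor_noise_apply, sq] using
        hnoise.ae_tendsto_average_sq_lag hb (S.idxPart i) (S.idxLag i)
    · simpa only [S.regressor_noise_apply] using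
        hnoise.ae_tendsto_average_lag_mul_lag hb hle (S.idx_injective.ne hij)
  -- Here the system noise is the martingale difference and the adapted regressor is the weight.
  have hφw : ∀ᵐ ω ∂P, ∀ i, Tendsto (fun n : ℕ => (n : ℝ)⁻¹ * ∑ k ∈ Finset.range n,
      S.regressor y u k ω i * w (k + 1) ω) atTop (𝓝 0) :=
    ae_all_iff.2 fun i => hw.ae_tendsto_average_mul hβ (fun k => hφF k i) (hφs i)
  -- Roles are exchanged: `w` belongs to the signals and serves as a predictable weight, while the
  -- privacy noise is the martingale difference.
  have hζw : ∀ᵐ ω ∂P, ∀ i, Tendsto (fun n : ℕ => (n : ℝ)⁻¹ * ∑ k ∈ Finset.range n,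
      w (k + 1) ω * S.regressor η ξ k ω i) atTop (𝓝 0) := by
    refine ae_all_iff.2 fun i => ?_
    have := hnoise.ae_tendsto_average_mul_lag hb hle (S.idxPart i) (S.idxLag i + 1)
      (fun k => PrivacyNoise.measurable_past_of_signal (PrivacyNoise.measurable_signal_w k))
      (hw.ae_summable hβ)
    simpa only [lag_succ_succ, S.regressor_noise_apply] using this
  have hφη : ∀ᵐ ω ∂P, ∀ i, Tendsto (fun n : ℕ => (n : ℝ)⁻¹ * ∑ k ∈ Finset.range n,
      S.regressor y u k ω i * η (k + 1) ω) atTop (𝓝 0) :=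
    ae_all_iff.2 fun i => hnoise.ae_tendsto_average_mul_lag hb hle 0 0
      (fun k => PrivacyNoise.measurable_past_of_signal (hφm k i)) (hφs i)
  have hζη : ∀ᵐ ω ∂P, ∀ i, Tendsto (fun n : ℕ => (n : ℝ)⁻¹ * ∑ k ∈ Finset.range n,
      -- The regressor noise at step `k` involves times at most `k`, so it precedes `η (k + 1)`.
      S.regressor η ξ k ω i * η (k + 1) ω) atTop (𝓝 0) := by
    refine ae_all_iff.2 fun i => ?_
    simp only [S.regressor_noise_apply]
    exact hnoise.ae_tendsto_average_mul_lag hb hle 0 0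
      (fun k => PrivacyNoise.measurable_past_lag (Or.inr (Nat.zero_le _)))
      (hnoise.ae_summable_lag hb _ _)
  set d : ℝ := Finset.univ.inf' Finset.univ_nonempty fun i => b i ^ 2 with hd
  have hd0 : 0 ≤ d := Finset.le_inf' _ _ fun i _ => sq_nonneg _
  filter_upwards [hφζ, hζζ, hφw, hζw, hφη, hζη, hliminf] with ω h1 h2 h3 h4 h5 h6 h7
  have hmain := limsup_norm_rls_error_le hα S.theta θ₀ (fun t => S.regressor y u t ω)
    (fun t => S.regressor η ξ t ω) (fun t => (y + η) t ω) (fun t => w (t + 1) ω + η (t + 1) ω)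
    (fun k => by
      have := (hy ω).2 k
      simp only [S.drift_eq_dotProduct] at this
      rw [Pi.add_apply, Pi.add_apply, this, add_assoc])
    (fun i => b (S.idxPart i) ^ 2) hγ₃ hd0 (fun i => Finset.inf'_le _ (Finset.mem_univ _)) h1 h2
    (fun i => by
      have := (((h3 i).add (h4 i)).add (h5 i)).add (h6 i)
      rw [add_zero, add_zero, add_zero] at this
      refine this.congr fun n => ?_
      rw [← mul_add, ← mul_add, ← mul_add, ← Finset.sum_add_distrib, ← Finset.sum_add_distrib,
        ← Finset.sum_add_distrib]
      congr 1
      refine Finset.sum_congr rfl fun k _ => ?_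
      ring) h7
  simp only [S.regressor_add]
  exact hmain.trans (EReal.coe_le_coe_iff.2 (S.sqrt_div_sqrt_le b (by positivity)))
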